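/- Let $n\ge 1$ and let $X$ be an $(n-1)$-connected, locally $(n-1)$-connected, separable metric space. Then for every base point $x\in X$ the following statements are equivalent: (i) $X$ is semilocally $n$-connected; (ii) $X$ is $n$-homotopically Hausdorff and $\pi_n(X,x)$ is countable. Here an $n$-loop at $y\in X$ is a continuous map $\alpha:[0,1]^n\to X$ with $\alpha(\partial [0,1]^n)=\{y\}$, and it is essential if it is not homotopic rel $\partial[0,1]^n$ to the constant $n$-loop at $y$. - $X$ is $m$-connected if it is path connected (in particular nonempty) and $\pi_k(X,y)$ is trivial for all $1\le k\le m$ and all $y\in X$. - $X$ is locally $m$-connected if for every $y\in X$ and every neighborhood $U$ of $y$ there is a neighborhood $V\subseteq U$ of $y$ such that for every $0\le k\le m$ each continuous map $S^k\to V$ extends to a continuous map $B^{k+1}\to U$. - $X$ is semilocally $n$-connected if every $y\in X$ has an open neighborhood $U$ such that the homomorphism $\pi_n(U,y)\to\pi_n(X,y)$ induced by the inclusion is trivial, i.e. every $n$-loop at $y$ lying in $U$ is homotopic rel $\partial[0,1]^n$ in $X$ to the constant loop. - $X$ is $n$-homotopically Hausdorff if for every $y\in X$ and every essential $n$-loop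 $\alpha$ at $y$ there is an open neighborhood $U$ of $y$ such that $\alpha$ is not homotopic rel $\partial [0,1]^n$ to any $n$-loop at $y$ lying entirely in $U$. -/

import Mathlib

open Topology

/-- `X` is `m`-connected: it is path connected (in particular nonempty) and `π_k(X, x)` is trivial
for every `1 ≤ k ≤ m` and every base point `x`. -/
def IsNConnected (m : ℕ) (X : Type*) [TopologicalSpace X] : Prop :=
  PathConnectedSpace X ∧
    ∀ k : ℕ, 1 ≤ k → k ≤ m → ∀ x : X, Subsingleton (HomotopyGroup.Pi k X x)

/-- `X` is locally `m`-connected (the condition `LC^m`): every neighborhood `U` of a point `x`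
contains a neighborhood `V` of `x` such that, for every `0 ≤ k ≤ m`, every continuous map of the
sphere `S^k` into `V` extends to a continuous map of the ball `B^(k+1)` into `U`.
(Maps on the sphere or the ball are represented by functions on the ambient Euclidean space that
are continuous on the sphere or the ball; their other values play no role.) -/
def IsLocallyNConnected (m : ℕ) (X : Type*) [TopologicalSpace X] : Prop :=
  ∀ x : X, ∀ U ∈ 𝓝 x, ∃ V ∈ 𝓝 x, V ⊆ U ∧
    ∀ k : ℕ, k ≤ m → ∀ f : EuclideanSpace ℝ (Fin (k + 1)) → X,
      ContinuousOn f (Metric.sphere 0 1) → Set.MapsTo f (Metric.sphere 0 1) V →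
      ∃ F : EuclideanSpace ℝ (Fin (k + 1)) → X,
        ContinuousOn F (Metric.closedBall 0 1) ∧ Set.MapsTo F (Metric.closedBall 0 1) U ∧
          Set.EqOn F f (Metric.sphere 0 1)

/-- `X` is semilocally `n`-connected at `x`: there is an open neighborhood `U` of `x` such that
the homomorphism `π_n(U, x) → π_n(X, x)` induced by inclusion is trivial, that is, every `n`-loop
at `x` lying in `U` is null-homotopic in `X` relative to the boundary of the cube. -/
def IsSemilocallyNConnectedAt (n : ℕ) {X : Type*} [TopologicalSpace X] (x : X) : Prop :=
  ∃ U : Set X, IsOpen U ∧ x ∈ U ∧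
    ∀ α : GenLoop (Fin n) X x, (∀ t, α t ∈ U) → GenLoop.Homotopic α GenLoop.const

/-- `X` is semilocally `n`-connected: it is so at each of its points. -/
def IsSemilocallyNConnected (n : ℕ) (X : Type*) [TopologicalSpace X] : Prop :=
  ∀ x : X, IsSemilocallyNConnectedAt n x

/-- `X` is `n`-homotopically Hausdorff at `x`: for every essential `n`-loop `α` at `x` there is an
open neighborhood `U` of `x` such that `α` is not homotopic, relative to the boundary of the cube,
to any `n`-loop at `x` lying in `U`. -/
def IsNHomotopicallyHausdorffAt (n : ℕ) {X : Type*} [TopologicalSpace X] (x : X) : Prop :=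
  ∀ α : GenLoop (Fin n) X x, ¬ GenLoop.Homotopic α GenLoop.const →
    ∃ U : Set X, IsOpen U ∧ x ∈ U ∧
      ∀ β : GenLoop (Fin n) X x, (∀ t, β t ∈ U) → ¬ GenLoop.Homotopic α β

/-- `X` is `n`-homotopically Hausdorff: it is so at each of its points. -/
def IsNHomotopicallyHausdorff (n : ℕ) (X : Type*) [TopologicalSpace X] : Prop :=
  ∀ x : X, IsNHomotopicallyHausdorffAt n x

/-! (i) ⇒ (ii). A neighborhood all of whose `n`-loops are null-homotopic contains no loop homotopic
to an essential one, which gives the Hausdorff property. For countability, view `π_n` as the set of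
path components of the `n`-fold loop space. Local path connectedness turns null-homotopies of small
loops into fillings of small free `n`-spheres (`sphereFills_of_genLoop_null`). Passing to a loop
space lowers the dimension of the fillable spheres by one (`LocallyFills.exists_nhds_loop`), so
after `n` steps nearby points of the iterated loop space are joined by paths
(`GenLoop.fills_of_fills`). That space is second countable, so a countable dense set meets every
component.

(ii) ⇒ (i). A path to `y` transports countability from `x` to `y`
(`HomotopyGroup.countable_of_path`). If semilocal connectedness failed at `y`, there would be loops
`α k` shrinking to `y`, none homotopic to a loop in the neighborhood containing all later ones. Each
0-1 sequence selects a subsequence with an infinite concatenation. At the first index where two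
sequences differ, cancelling common factors would express `α k` by later loops, so distinct
sequences give distinct classes (`GenLoop.eq_of_infiniteConcat_homotopic`): uncountably many. -/

/-! ### Infinite concatenations of shrinking loops -/

section InfiniteConcatenation

open Filter

variable {N X : Type*} [DecidableEq N]

theorem GenLoop.transAt_apply [TopologicalSpace X] {y : X} (i : N) (f g : GenLoop N X y)
    (t : N → unitInterval) :
    GenLoop.transAt i f g t = if (t i : ℝ) ≤ 1 / 2
      then f (Function.update t i <| Set.projIcc 0 1 zero_le_one (2 * (t i : ℝ)))
      else g (Function.update t i <| Set.projIcc 0 1 zero_le_one (2 * (t i : ℝ) - 1)) := rfl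

theorem GenLoop.transAt_mem [TopologicalSpace X] {y : X} (i : N) {f g : GenLoop N X y} {U : Set X}
    (hf : ∀ t, f t ∈ U) (hg : ∀ t, g t ∈ U) (t : N → unitInterval) :
    GenLoop.transAt i f g t ∈ U := by
  rw [GenLoop.transAt_apply]
  split_ifs
  exacts [hf _, hg _]

theorem GenLoop.symmAt_mem [TopologicalSpace X] {y : X} (i : N) {f : GenLoop N X y} {U : Set X}
    (hf : ∀ t, f t ∈ U) (t : N → unitInterval) : GenLoop.symmAt i f t ∈ U :=
  hf fun j => if j = i then unitInterval.symm (t i) else t j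

/-- The concatenation `a 0 * (a 1 * (⋯ * (a (m - 1) * const)))` along the `i`th coordinate. -/
noncomputable def GenLoop.finiteConcat [TopologicalSpace X] {y : X} (i : N) :
    ℕ → (ℕ → GenLoop N X y) → GenLoop N X y
  | 0, _ => GenLoop.const
  | m + 1, a => GenLoop.transAt i (a 0) (GenLoop.finiteConcat i m fun k => a (k + 1))

namespace GenLoop

section HomotopyClass

variable [TopologicalSpace X] {y : X}

/-- The class of a generalized loop in the homotopy group. -/
def homotopyClass (f : GenLoop N X y) : HomotopyGroup N X y :=
  Quotient.mk (Homotopic.setoid N y) f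

omit [DecidableEq N] in
theorem homotopyClass_eq_iff {f g : GenLoop N X y} :
    homotopyClass f = homotopyClass g ↔ Homotopic f g :=
  Quotient.eq

variable [Nonempty N] (i : N)

theorem homotopyClass_const : homotopyClass (const : GenLoop N X y) = 1 := rfl

/-- The reversed order is the convention of `HomotopyGroup.mul_spec`. -/
theorem homotopyClass_transAt (f g : GenLoop N X y) :
    homotopyClass (transAt i f g) = homotopyClass g * homotopyClass f :=
  HomotopyGroup.mul_spec.symm

theorem homotopyClass_symmAt (f : GenLoop N X y) :
    homotopyClass (symmAt i f) = (homotopyClass f)⁻¹ :=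
  HomotopyGroup.inv_spec.symm

end HomotopyClass

section Topological

variable [TopologicalSpace X] {y : X} (i : N)

theorem finiteConcat_mem {U : Set X} (hy : y ∈ U) (m : ℕ) :
    ∀ a : ℕ → GenLoop N X y, (∀ k t, a k t ∈ U) → ∀ t, finiteConcat i m a t ∈ U := by
  induction m with
  | zero => intro a _ t; simpa [finiteConcat] using hy
  | succ m ih =>
    intro a ha t
    exact transAt_mem i (ha 0) (ih _ fun k => ha (k + 1)) t

/-- Factor number `j` occupies the slab from `1 - 2⁻ʲ` to `1 - 2⁻ʲ⁻¹`, so below `1 - 2⁻ᵏ` only the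
first `k` factors are seen. -/
theorem finiteConcat_stable (k : ℕ) : ∀ (a : ℕ → GenLoop N X y) (t : N → unitInterval),
    (1 / 2 : ℝ) ^ k ≤ 1 - t i → ∀ m, k ≤ m → finiteConcat i m a t = finiteConcat i k a t := by
  induction k with
  | zero =>
    intro a t ht m _
    have h0 : t i = 0 := by
      apply Subtype.ext
      have := (t i).2.1
      simp only [pow_zero] at ht
      exact le_antisymm (by simpa using ht) this
    rw [GenLoop.boundary _ t ⟨i, Or.inl h0⟩, GenLoop.boundary _ t ⟨i, Or.inl h0⟩]
  | succ k ih =>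
    intro a t ht m hm
    obtain ⟨m, rfl⟩ : ∃ m', m = m' + 1 := ⟨m - 1, by omega⟩
    simp only [finiteConcat, transAt_apply]
    split_ifs with h
    · rfl
    · apply ih _ _ _ m (by omega)
      have h1 := (t i).2.2
      rw [Function.update_self, Set.projIcc_of_mem zero_le_one (x := 2 * (t i : ℝ) - 1)
        ⟨by linarith, by linarith⟩]
      rw [pow_succ] at ht
      simp only
      linarith

theorem exists_eventually_finiteConcat_eq (a : ℕ → GenLoop N X y) (t : N → unitInterval) :
    ∃ v, ∀ᶠ m in atTop, finiteConcat i m a t = v := by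
  by_cases h1 : t i = 1
  · exact ⟨y, Eventually.of_forall fun m => GenLoop.boundary _ t ⟨i, Or.inr h1⟩⟩
  · have hlt : (t i : ℝ) < 1 := lt_of_le_of_ne (t i).2.2 fun h => h1 (Subtype.ext h)
    obtain ⟨k, hk⟩ := exists_pow_lt_of_lt_one (sub_pos.2 hlt) (by norm_num : (1 / 2 : ℝ) < 1)
    exact ⟨_, (eventually_ge_atTop k).mono fun m hm => finiteConcat_stable i k a t hk.le m hm⟩

/-- The underlying function of the infinite concatenation `a 0 * (a 1 * (a 2 * ⋯))`. -/
noncomputable def infiniteConcatFun (a : ℕ → GenLoop N X y) (t : N → unitInterval) : X :=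
  (exists_eventually_finiteConcat_eq i a t).choose

theorem eventually_finiteConcat_eq (a : ℕ → GenLoop N X y) (t : N → unitInterval) :
    ∀ᶠ m in atTop, finiteConcat i m a t = infiniteConcatFun i a t :=
  (exists_eventually_finiteConcat_eq i a t).choose_spec

theorem infiniteConcatFun_eq_of_eventually {a : ℕ → GenLoop N X y} {t : N → unitInterval} {v : X}
    (h : ∀ᶠ m in atTop, finiteConcat i m a t = v) : infiniteConcatFun i a t = v := by
  obtain ⟨m, h1, h2⟩ := (h.and (eventually_finiteConcat_eq i a t)).exists
  exact h2.symm.trans h1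

theorem infiniteConcatFun_apply (a : ℕ → GenLoop N X y) (t : N → unitInterval) :
    infiniteConcatFun i a t = if (t i : ℝ) ≤ 1 / 2
      then a 0 (Function.update t i <| Set.projIcc 0 1 zero_le_one (2 * (t i : ℝ)))
      else infiniteConcatFun i (fun k => a (k + 1))
        (Function.update t i <| Set.projIcc 0 1 zero_le_one (2 * (t i : ℝ) - 1)) := by
  apply infiniteConcatFun_eq_of_eventually
  rw [← map_add_atTop_eq_nat 1, eventually_map]
  split_ifs with h
  · exact Eventually.of_forall fun m => by simp only [finiteConcat, transAt_apply, if_pos h]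
  · filter_upwards [eventually_finiteConcat_eq i (fun k => a (k + 1))
        (Function.update t i <| Set.projIcc 0 1 zero_le_one (2 * (t i : ℝ) - 1))] with m hm
    simp only [finiteConcat, transAt_apply, if_neg h, hm]

theorem infiniteConcatFun_mem {U : Set X} (hy : y ∈ U) {a : ℕ → GenLoop N X y}
    (ha : ∀ k t, a k t ∈ U) (t : N → unitInterval) : infiniteConcatFun i a t ∈ U := by
  obtain ⟨m, hm⟩ := (eventually_finiteConcat_eq i a t).exists
  exact hm ▸ finiteConcat_mem i hy m a ha t

theorem infiniteConcatFun_boundary (a : ℕ → GenLoop N X y) {t : N → unitInterval}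
    (ht : t ∈ Cube.boundary N) : infiniteConcatFun i a t = y :=
  infiniteConcatFun_eq_of_eventually i (Eventually.of_forall fun _ => GenLoop.boundary _ t ht)

/-- Beyond the first `m` factors only loops in `U m` remain. For shrinking `U` this makes the
convergence uniform, hence the limit continuous. -/
theorem infiniteConcatFun_eq_or_mem (m : ℕ) : ∀ (a : ℕ → GenLoop N X y) (U : ℕ → Set X),
    Antitone U → (∀ k, y ∈ U k) → (∀ k t, a k t ∈ U k) → ∀ t,
    infiniteConcatFun i a t = finiteConcat i m a t ∨
      (infiniteConcatFun i a t ∈ U m ∧ finiteConcat i m a t ∈ U m) := by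
  induction m with
  | zero =>
    intro a U hU hy ha t
    exact Or.inr ⟨infiniteConcatFun_mem i (hy 0) (fun k t => hU (Nat.zero_le k) (ha k t)) t, hy 0⟩
  | succ m ih =>
    intro a U hU hy ha t
    rw [infiniteConcatFun_apply]
    simp only [finiteConcat, transAt_apply]
    split_ifs with h
    · exact Or.inl rfl
    · exact ih (fun k => a (k + 1)) (fun k => U (k + 1)) (fun k l hkl => hU (by omega))
        (fun k => hy _) (fun k => ha _) _

end Topological

variable [PseudoMetricSpace X] {y : X} (i : N)

theorem continuous_infiniteConcatFun {a : ℕ → GenLoop N X y} {U : ℕ → Set X} (hU : Antitone U)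
    (hy : ∀ k, y ∈ U k) (ha : ∀ k t, a k t ∈ U k)
    (hsmall : ∀ ε > 0, ∃ k, U k ⊆ Metric.ball y ε) : Continuous (infiniteConcatFun i a) := by
  apply continuous_of_uniform_approx_of_continuous
  intro u hu
  obtain ⟨ε, hε, hεu⟩ := Metric.mem_uniformity_dist.1 hu
  obtain ⟨m, hm⟩ := hsmall (ε / 2) (half_pos hε)
  refine ⟨finiteConcat i m a, (finiteConcat i m a).1.continuous, fun t => hεu ?_⟩
  rcases infiniteConcatFun_eq_or_mem i m a U hU hy ha t with h | ⟨h1, h2⟩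
  · rw [h, dist_self]; exact hε
  · have h1 := Metric.mem_ball.1 (hm h1)
    have h2 := Metric.mem_ball'.1 (hm h2)
    linarith [dist_triangle (infiniteConcatFun i a t) y (finiteConcat i m a t)]

/-- The infinite concatenation of a sequence of loops that shrinks to the base point. -/
noncomputable def infiniteConcat (a : ℕ → GenLoop N X y) {U : ℕ → Set X} (hU : Antitone U)
    (hy : ∀ k, y ∈ U k) (ha : ∀ k t, a k t ∈ U k)
    (hsmall : ∀ ε > 0, ∃ k, U k ⊆ Metric.ball y ε) : GenLoop N X y :=
  ⟨⟨infiniteConcatFun i a, continuous_infiniteConcatFun i hU hy ha hsmall⟩,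
    fun _ ht => infiniteConcatFun_boundary i a ht⟩

theorem infiniteConcat_mem {a : ℕ → GenLoop N X y} {U : ℕ → Set X} (hU : Antitone U)
    (hy : ∀ k, y ∈ U k) (ha : ∀ k t, a k t ∈ U k)
    (hsmall : ∀ ε > 0, ∃ k, U k ⊆ Metric.ball y ε) (t : N → unitInterval) :
    infiniteConcat i a hU hy ha hsmall t ∈ U 0 :=
  infiniteConcatFun_mem i (hy 0) (fun k t => hU (Nat.zero_le k) (ha k t)) t

theorem infiniteConcat_eq_transAt {a : ℕ → GenLoop N X y} {U : ℕ → Set X} (hU : Antitone U)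
    (hy : ∀ k, y ∈ U k) (ha : ∀ k t, a k t ∈ U k) (hsmall : ∀ ε > 0, ∃ k, U k ⊆ Metric.ball y ε)
    (hU' : Antitone fun k => U (k + 1)) (hsmall' : ∀ ε > 0, ∃ k, U (k + 1) ⊆ Metric.ball y ε) :
    infiniteConcat i a hU hy ha hsmall = transAt i (a 0) (infiniteConcat i (fun k => a (k + 1)) hU'
      (fun k => hy (k + 1)) (fun k => ha (k + 1)) hsmall') := by
  ext t
  exact infiniteConcatFun_apply i _ t

/-- The subsequence `α k`, `k ∈ s`, of a sequence of loops, padded with constant loops. -/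
noncomputable def select (α : ℕ → GenLoop N X y) (s : ℕ → Bool) (k : ℕ) : GenLoop N X y :=
  if s k then α k else const

omit [DecidableEq N] in
theorem select_mem {α : ℕ → GenLoop N X y} {U : ℕ → Set X} (hy : ∀ k, y ∈ U k)
    (hα : ∀ k t, α k t ∈ U k) (s : ℕ → Bool) (k : ℕ) (t : N → unitInterval) :
    select α s k t ∈ U k := by
  unfold select
  split_ifs
  exacts [hα k t, hy k]

/-- Induction on `k`: the first entries must agree, the common first factor cancels in the group,
and the tails are again of the same form. -/
theorem eq_of_infiniteConcat_homotopic [Nonempty N] (k : ℕ) :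
    ∀ (α : ℕ → GenLoop N X y) (U : ℕ → Set X) (hU : Antitone U) (hy : ∀ k, y ∈ U k)
      (hα : ∀ k t, α k t ∈ U k) (hsmall : ∀ ε > 0, ∃ k, U k ⊆ Metric.ball y ε)
      (_ : ∀ k (β : GenLoop N X y), (∀ t, β t ∈ U (k + 1)) → ¬ Homotopic (α k) β)
      (s s' : ℕ → Bool),
      Homotopic (infiniteConcat i (select α s) hU hy (select_mem hy hα s) hsmall)
        (infiniteConcat i (select α s') hU hy (select_mem hy hα s') hsmall) → s k = s' k := by
  have tail (α : ℕ → GenLoop N X y) (U : ℕ → Set X) (hU : Antitone U) (hy : ∀ k, y ∈ U k)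
      (hα : ∀ k t, α k t ∈ U k) (hsmall : ∀ ε > 0, ∃ k, U k ⊆ Metric.ball y ε) :
      ∃ (hU' : Antitone fun k => U (k + 1)) (hs' : ∀ ε > 0, ∃ k, U (k + 1) ⊆ Metric.ball y ε),
      ∀ s, ∃ b, (∀ t, b t ∈ U 1) ∧
        b = infiniteConcat i (select (fun k => α (k + 1)) fun k => s (k + 1)) hU'
          (fun k => hy (k + 1)) (select_mem (fun k => hy (k + 1)) (fun k => hα (k + 1))
          fun k => s (k + 1)) hs' ∧
        infiniteConcat i (select α s) hU hy (select_mem hy hα s) hsmall =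
          transAt i (select α s 0) b := by
    have hU' : Antitone fun k => U (k + 1) := fun k l hkl => hU (by omega)
    have hs' : ∀ ε > 0, ∃ k, U (k + 1) ⊆ Metric.ball y ε := fun ε hε =>
      (hsmall ε hε).imp fun k hk => (hU (Nat.le_succ k)).trans hk
    exact ⟨hU', hs', fun s => ⟨_, fun t => infiniteConcat_mem i hU' _ _ hs' t, rfl,
      infiniteConcat_eq_transAt i hU hy _ hsmall hU' hs'⟩⟩
  -- If only `s` selects `α 0`, then `[b] * [α 0] = [b']`, so `α 0` is homotopic to a concatenation
  -- of `b'` and the inverse of `b`, which lies in `U 1`.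
  have head (α : ℕ → GenLoop N X y) (U : ℕ → Set X)
      (hne : ∀ k (β : GenLoop N X y), (∀ t, β t ∈ U (k + 1)) → ¬ Homotopic (α k) β)
      (s s' : ℕ → Bool) (b b' : GenLoop N X y) (hb : ∀ t, b t ∈ U 1) (hb' : ∀ t, b' t ∈ U 1)
      (hh : Homotopic (transAt i (select α s 0) b) (transAt i (select α s' 0) b'))
      (h : s 0 = true) (h' : s' 0 = false) : False := by
    have e := homotopyClass_eq_iff.2 hh
    simp only [select, h, h', if_true, Bool.false_eq_true, if_false, homotopyClass_transAt,
      homotopyClass_const, mul_one] at e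
    rw [← eq_inv_mul_iff_mul_eq, ← homotopyClass_symmAt i, ← homotopyClass_transAt] at e
    exact hne 0 (transAt i b' (symmAt i b)) (transAt_mem i hb' (symmAt_mem i hb))
      (homotopyClass_eq_iff.1 e)
  have first (α : ℕ → GenLoop N X y) (U : ℕ → Set X) (hU : Antitone U) (hy : ∀ k, y ∈ U k)
      (hα : ∀ k t, α k t ∈ U k) (hsmall : ∀ ε > 0, ∃ k, U k ⊆ Metric.ball y ε)
      (hne : ∀ k (β : GenLoop N X y), (∀ t, β t ∈ U (k + 1)) → ¬ Homotopic (α k) β)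
      (s s' : ℕ → Bool)
      (hh : Homotopic (infiniteConcat i (select α s) hU hy (select_mem hy hα s) hsmall)
        (infiniteConcat i (select α s') hU hy (select_mem hy hα s') hsmall)) : s 0 = s' 0 := by
    obtain ⟨hU', hs', ht⟩ := tail α U hU hy hα hsmall
    obtain ⟨b, hb, -, e⟩ := ht s
    obtain ⟨b', hb', -, e'⟩ := ht s'
    rw [e, e'] at hh
    cases h : s 0 <;> cases h' : s' 0
    · rfl
    · exact (head α U hne s' s _ _ hb' hb hh.symm h' h).elim
    · exact (head α U hne s s' _ _ hb hb' hh h h').elim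
    · rfl
  induction k with
  | zero => exact first
  | succ k ih =>
    intro α U hU hy hα hsmall hne s s' hh
    have h0 := first α U hU hy hα hsmall hne s s' hh
    obtain ⟨hU', hs', ht⟩ := tail α U hU hy hα hsmall
    refine ih (fun k => α (k + 1)) (fun k => U (k + 1)) hU' (fun k => hy _) (fun k => hα _) hs'
      (fun k => hne _) (fun k => s (k + 1)) (fun k => s' (k + 1)) ?_
    obtain ⟨b, -, hb, hs⟩ := ht s
    obtain ⟨b', -, hb', hs₁⟩ := ht s'
    rw [hs, hs₁] at hh
    rw [← hb, ← hb']
    have e := homotopyClass_eq_iff.2 hh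
    have hsel : select α s 0 = select α s' 0 := by simp only [select, h0]
    rw [homotopyClass_transAt, homotopyClass_transAt, hsel] at e
    exact homotopyClass_eq_iff.1 (mul_right_cancel e)

end GenLoop

theorem isSemilocallyNConnectedAt_of_countable [PseudoMetricSpace X] {n : ℕ} (hn : 1 ≤ n) {y : X}
    (hH : IsNHomotopicallyHausdorffAt n y) (hc : Countable (HomotopyGroup.Pi n X y)) :
    IsSemilocallyNConnectedAt n y := by
  by_contra hns
  have : Nonempty (Fin n) := ⟨⟨0, hn⟩⟩
  -- Failure of semilocal connectedness puts an essential loop in `U`; the Hausdorff property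
  -- supplies `V` for it.
  have step (U : {U : Set X // IsOpen U ∧ y ∈ U}) : ∃ (α : GenLoop (Fin n) X y)
      (V : {U : Set X // IsOpen U ∧ y ∈ U}), (∀ t, α t ∈ U.1) ∧
        ∀ β : GenLoop (Fin n) X y, (∀ t, β t ∈ V.1) → ¬ GenLoop.Homotopic α β := by
    by_contra! h
    refine hns ⟨U.1, U.2.1, U.2.2, fun α hα => ?_⟩
    by_contra hess
    obtain ⟨V, hVo, hyV, hV⟩ := hH α hess
    obtain ⟨β, hβ, hαβ⟩ := h α ⟨V, hVo, hyV⟩ hα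
    exact hV β hβ hαβ
  choose loop next hloop hnext using step
  -- Intersecting with `next` separates each loop from all later ones; the balls make the loops
  -- shrink to `y`.
  let W : ℕ → {U : Set X // IsOpen U ∧ y ∈ U} := fun k => Nat.rec ⟨Set.univ, isOpen_univ, trivial⟩
    (fun k U => ⟨U.1 ∩ (next U).1 ∩ Metric.ball y (1 / ((k : ℝ) + 1)),
      (U.2.1.inter (next U).2.1).inter Metric.isOpen_ball,
      ⟨U.2.2, (next U).2.2⟩, Metric.mem_ball_self (by positivity)⟩) k
  have hW (k : ℕ) : (W (k + 1)).1 = (W k).1 ∩ (next (W k)).1 ∩ Metric.ball y (1 / ((k : ℝ) + 1)) :=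
    rfl
  have hanti : Antitone fun k => (W k).1 :=
    antitone_nat_of_succ_le fun k => by rw [hW]; exact fun z hz => hz.1.1
  have hsmall : ∀ ε > 0, ∃ k, (W k).1 ⊆ Metric.ball y ε := fun ε hε => by
    obtain ⟨k, hk⟩ := exists_nat_one_div_lt hε
    exact ⟨k + 1, fun z hz => Metric.ball_subset_ball hk.le ((hW k).subset hz).2⟩
  have hy (k : ℕ) : y ∈ (W k).1 := (W k).2.2
  have hα (k : ℕ) := hloop (W k)
  have hinj : Function.Injective fun s : ℕ → Bool =>
      GenLoop.homotopyClass (GenLoop.infiniteConcat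
        (Classical.arbitrary (Fin n)) (GenLoop.select (fun k => loop (W k)) s) hanti hy
        (GenLoop.select_mem hy hα s) hsmall) := fun s s' hss' => by
    funext k
    exact GenLoop.eq_of_infiniteConcat_homotopic _ k _ _ hanti hy hα hsmall
      (fun k β hβ => hnext (W k) β fun t => ((hW k).subset (hβ t)).1.2) s s'
      (GenLoop.homotopyClass_eq_iff.1 hss')
  have : Countable (ℕ → Bool) := hinj.countable
  have hle := Cardinal.mk_le_aleph0_iff.2 this
  simp only [Cardinal.mk_pi, Cardinal.mk_bool, Cardinal.prod_const, Cardinal.lift_id,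
    Cardinal.mk_nat] at hle
  exact absurd hle (not_le.2 (Cardinal.cantor _))

end InfiniteConcatenation

/-! ### Change of base point along a path -/

section BasePointChange

variable {N X : Type*} [TopologicalSpace X]

theorem GenLoop.homotopic_of_continuous {y : X} {f g : GenLoop N X y}
    (H : unitInterval × (N → unitInterval) → X) (hH : Continuous H) (h0 : ∀ t, H (0, t) = f t)
    (h1 : ∀ t, H (1, t) = g t) (hb : ∀ s, ∀ t ∈ Cube.boundary N, H (s, t) = y) :
    GenLoop.Homotopic f g :=
  ⟨{  toFun := H
      continuous_toFun := hH
      map_zero_left := h0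
      map_one_left := h1
      prop' := fun s t ht => (hb s t ht).trans (GenLoop.boundary f t ht).symm }⟩

namespace Cube

/-- The affine map from the unit cube onto the unit ball of the supremum norm. -/
def toBall (t : N → unitInterval) (i : N) : ℝ := 2 * t i - 1

/-- The retraction of the whole space onto the unit ball of the supremum norm, with the latter
identified with the unit cube. -/
noncomputable def ofSpace (v : N → ℝ) (i : N) : unitInterval :=
  Set.projIcc 0 1 zero_le_one ((v i + 1) / 2)

theorem continuous_toBall : Continuous (toBall : (N → unitInterval) → N → ℝ) := by
  unfold toBall
  fun_prop

theorem continuous_ofSpace : Continuous (ofSpace : (N → ℝ) → N → unitInterval) := by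
  refine continuous_pi fun i => continuous_projIcc.comp ?_
  fun_prop

theorem ofSpace_toBall (t : N → unitInterval) : ofSpace (toBall t) = t := by
  funext i
  have : (toBall t i + 1) / 2 = t i := by unfold toBall; ring
  rw [ofSpace, this, Set.projIcc_val]

variable [Fintype N]

theorem norm_toBall_le (t : N → unitInterval) : ‖toBall t‖ ≤ 1 := by
  refine (pi_norm_le_iff_of_nonneg zero_le_one).2 fun i => ?_
  rw [Real.norm_eq_abs, toBall, abs_le]
  constructor <;> linarith [(t i).2.1, (t i).2.2]

theorem norm_toBall_of_mem_boundary {t : N → unitInterval} (ht : t ∈ boundary N) :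
    ‖toBall t‖ = 1 := by
  refine le_antisymm (norm_toBall_le t) ?_
  obtain ⟨i, hi⟩ := ht
  refine le_trans ?_ (norm_le_pi_norm _ i)
  rcases hi with hi | hi <;> rw [toBall, hi] <;> norm_num

theorem toBall_ofSpace {v : N → ℝ} (hv : ‖v‖ ≤ 1) : toBall (ofSpace v) = v := by
  funext i
  have := abs_le.1 ((norm_le_pi_norm v i).trans hv)
  rw [toBall, ofSpace, Set.projIcc_of_mem zero_le_one (x := (v i + 1) / 2)
    ⟨by linarith [this.1], by linarith [this.2]⟩]
  ring

theorem ofSpace_mem_boundary {v : N → ℝ} (hv : 1 ≤ ‖v‖) : ofSpace v ∈ boundary N := by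
  obtain ⟨i, hi⟩ : ∃ i, 1 ≤ ‖v i‖ := by
    by_contra! h
    exact absurd hv (not_le.2 ((pi_norm_lt_iff one_pos).2 h))
  refine ⟨i, ?_⟩
  rw [Real.norm_eq_abs, le_abs'] at hi
  rcases hi with hi | hi
  · exact Or.inl (Set.projIcc_of_le_left _ (by linarith))
  · exact Or.inr (Set.projIcc_of_right_le _ (by linarith))

end Cube

namespace GenLoop

open Cube

variable [Fintype N] {y z : X}

/-- A generalized loop, followed radially outside the cube by a path. -/
noncomputable def extendAlong (α : GenLoop N X y) (p : Path y z) (v : N → ℝ) : X :=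
  if ‖v‖ ≤ 1 then α (ofSpace v) else p.extend (‖v‖ - 1)

theorem continuous_extendAlong (α : GenLoop N X y) (p : Path y z) :
    Continuous (extendAlong α p) := by
  refine Continuous.if_le (α.1.continuous.comp continuous_ofSpace)
    (p.continuous_extend.comp (continuous_norm.sub continuous_const)) continuous_norm
    continuous_const fun v hv => ?_
  rw [hv, sub_self, Path.extend_zero]
  exact GenLoop.boundary α _ (ofSpace_mem_boundary hv.ge)

theorem extendAlong_of_le (α : GenLoop N X y) (p : Path y z) {v : N → ℝ} (hv : ‖v‖ ≤ 1) :
    extendAlong α p v = α (ofSpace v) := if_pos hv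

theorem extendAlong_of_ge (α : GenLoop N X y) (p : Path y z) {v : N → ℝ} (hv : 1 ≤ ‖v‖) :
    extendAlong α p v = p.extend (‖v‖ - 1) := by
  rcases hv.eq_or_lt with h | h
  · rw [extendAlong_of_le _ _ h.ge, ← h, sub_self, Path.extend_zero]
    exact GenLoop.boundary α _ (ofSpace_mem_boundary hv)
  · exact if_neg (not_le.2 h)

theorem norm_smul_toBall {r : ℝ} (hr : 0 ≤ r) (t : N → unitInterval) :
    ‖r • toBall t‖ = r * ‖toBall t‖ := by rw [norm_smul, Real.norm_of_nonneg hr]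

/-- The generalized loop at `z` that results from a generalized loop at `y` and a path from `y`
to `z`. -/
noncomputable def whisker (α : GenLoop N X y) (p : Path y z) : GenLoop N X z :=
  ⟨⟨fun t => extendAlong α p ((2 : ℝ) • toBall t),
    (continuous_extendAlong α p).comp (continuous_toBall.const_smul (2 : ℝ))⟩, fun t ht => by
    have hn : ‖(2 : ℝ) • toBall t‖ = 2 := by
      rw [norm_smul_toBall zero_le_two, norm_toBall_of_mem_boundary ht, mul_one]
    change extendAlong α p ((2 : ℝ) • toBall t) = z
    rw [extendAlong_of_ge _ _ (by rw [hn]; norm_num), hn]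
    norm_num⟩

theorem whisker_apply (α : GenLoop N X y) (p : Path y z) (t : N → unitInterval) :
    whisker α p t = extendAlong α p ((2 : ℝ) • toBall t) := rfl

theorem Homotopic.whisker {α α' : GenLoop N X y} (h : Homotopic α α') (p : Path y z) :
    Homotopic (whisker α p) (whisker α' p) := by
  obtain ⟨G⟩ := h
  have hG (s : unitInterval) (t) (ht : t ∈ Cube.boundary N) : G (s, t) = y :=
    (G.eq_fst s ht).trans (GenLoop.boundary α t ht)
  refine homotopic_of_continuous (fun q => if ‖(2 : ℝ) • toBall q.2‖ ≤ 1
    then G (q.1, ofSpace ((2 : ℝ) • toBall q.2))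
    else p.extend (‖(2 : ℝ) • toBall q.2‖ - 1)) ?_ (fun t => ?_) (fun t => ?_) fun s t ht => ?_
  · have hc : Continuous fun q : unitInterval × (N → unitInterval) => (2 : ℝ) • toBall q.2 :=
      (continuous_toBall.comp continuous_snd).const_smul (2 : ℝ)
    refine Continuous.if_le (G.continuous.comp
      (continuous_fst.prodMk (continuous_ofSpace.comp hc)))
      (p.continuous_extend.comp (hc.norm.sub continuous_const)) hc.norm continuous_const
      fun q hq => ?_
    rw [hq, sub_self, Path.extend_zero]
    exact hG _ _ (ofSpace_mem_boundary hq.ge)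
  · simp only [G.apply_zero]; rfl
  · simp only [G.apply_one]; rfl
  · have hn : ‖(2 : ℝ) • toBall t‖ = 2 := by
      rw [norm_smul_toBall zero_le_two, norm_toBall_of_mem_boundary ht, mul_one]
    simp only [hn]
    norm_num

/-- Rescaling the cube by `1 + s` brings in a collar on which the constant path stays at `y`. -/
theorem homotopic_whisker_refl (β : GenLoop N X y) : Homotopic β (whisker β (Path.refl y)) := by
  refine homotopic_of_continuous
    (fun q => extendAlong β (Path.refl y) ((1 + (q.1 : ℝ)) • toBall q.2))
    ((continuous_extendAlong _ _).comp ?_) (fun t => ?_) (fun t => ?_) fun s t ht => ?_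
  · exact (by fun_prop : Continuous fun q : unitInterval × (N → unitInterval) =>
      1 + (q.1 : ℝ)).smul (continuous_toBall.comp continuous_snd)
  · simp only [Set.Icc.coe_zero, add_zero, one_smul]
    rw [extendAlong_of_le _ _ (norm_toBall_le t), ofSpace_toBall]
  · rw [whisker_apply]
    norm_num
  · have hs := s.2.1
    simp only
    rw [extendAlong_of_ge, Path.refl_extend, ContinuousMap.const_apply]
    rw [norm_smul_toBall (by linarith), norm_toBall_of_mem_boundary ht]
    linarith

/-- At time `s` the collar follows `p` out to parameter `s` and then returns along it to `y`. -/
theorem homotopic_whisker_symm (β : GenLoop N X y) (p : Path y z) :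
    Homotopic (whisker β (Path.refl y)) (whisker (whisker β p) p.symm) := by
  refine homotopic_of_continuous (fun q => if ‖(2 : ℝ) • toBall q.2‖ ≤ 1
    then extendAlong β p ((1 + (q.1 : ℝ)) • (2 : ℝ) • toBall q.2)
    else p.extend (q.1 * (2 - ‖(2 : ℝ) • toBall q.2‖))) ?_ (fun t => ?_) (fun t => ?_)
    fun s t ht => ?_
  · have hc : Continuous fun q : unitInterval × (N → unitInterval) => (2 : ℝ) • toBall q.2 :=
      (continuous_toBall.comp continuous_snd).const_smul (2 : ℝ)
    have hs : Continuous fun q : unitInterval × (N → unitInterval) => (q.1 : ℝ) := by fun_prop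
    refine Continuous.if_le ((continuous_extendAlong _ _).comp
      ((continuous_const.add hs).smul hc))
      (p.continuous_extend.comp (hs.mul (continuous_const.sub hc.norm))) hc.norm continuous_const
      fun q hq => ?_
    have h0 := q.1.2.1
    have hn : ‖(1 + (q.1 : ℝ)) • (2 : ℝ) • toBall q.2‖ = 1 + (q.1 : ℝ) := by
      rw [norm_smul, hq, mul_one, Real.norm_of_nonneg (by linarith)]
    rw [extendAlong_of_ge _ _ (by rw [hn]; linarith), hn, hq]
    ring_nf
  · rw [whisker_apply]
    simp only [Set.Icc.coe_zero, add_zero, one_smul, zero_mul, Path.extend_zero]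
    split_ifs with h
    · rw [extendAlong_of_le _ _ h, extendAlong_of_le _ _ h]
    · rw [extendAlong_of_ge _ _ (not_le.1 h).le, Path.refl_extend, ContinuousMap.const_apply]
  · rw [whisker_apply]
    simp only [Set.Icc.coe_one, one_mul]
    split_ifs with h
    · rw [extendAlong_of_le _ _ h, whisker_apply, toBall_ofSpace h]
      norm_num
    · rw [extendAlong_of_ge _ _ (not_le.1 h).le, Path.extend_symm_apply]
      ring_nf
  · have hn : ‖(2 : ℝ) • toBall t‖ = 2 := by
      rw [norm_smul_toBall zero_le_two, norm_toBall_of_mem_boundary ht, mul_one]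
    simp only [hn]
    norm_num

end GenLoop

/-- Surjectivity of whiskering along `p.symm` is enough: whiskering `β` along `p` gives a preimage
of its class. -/
theorem HomotopyGroup.countable_of_path [Fintype N] {y z : X} (p : Path y z)
    (h : Countable (HomotopyGroup N X z)) : Countable (HomotopyGroup N X y) := by
  have hsurj : Function.Surjective (Quotient.map (sa := GenLoop.Homotopic.setoid N z)
      (sb := GenLoop.Homotopic.setoid N y) (fun α => GenLoop.whisker α p.symm)
      fun _ _ hα => GenLoop.Homotopic.whisker hα p.symm) := by
    rintro ⟨β⟩
    exact ⟨Quotient.mk _ (GenLoop.whisker β p), Quotient.sound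
      (((GenLoop.homotopic_whisker_refl β).trans (GenLoop.homotopic_whisker_symm β p)).symm)⟩
  exact Function.Surjective.countable (α := HomotopyGroup N X z) hsurj

end BasePointChange

/-! ### Filling spheres, and the transfer to convex bodies -/

section Filling

variable {E E' X : Type*} [TopologicalSpace E] [TopologicalSpace E'] [TopologicalSpace X]

/-- Every continuous map of `S` into `V` extends to a continuous map of `K` into `U`. -/
def Fills (K S : Set E) (V U : Set X) : Prop :=
  ∀ f : E → X, ContinuousOn f S → Set.MapsTo f S V →
    ∃ F : E → X, ContinuousOn F K ∧ Set.MapsTo F K U ∧ Set.EqOn F f S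

/-- Every continuous map of the `(m - 1)`-sphere into `V` extends to a continuous map of the
`m`-ball into `U`. -/
def SphereFills (m : ℕ) (V U : Set X) : Prop :=
  Fills (Metric.closedBall (0 : EuclideanSpace ℝ (Fin m)) 1) (Metric.sphere 0 1) V U

theorem Fills.of_image {K S : Set E} {V U : Set X} (h : E ≃ₜ E')
    (H : Fills (h '' K) (h '' S) V U) : Fills K S V U := by
  intro f hf hfV
  obtain ⟨F, hF, hFU, hFf⟩ := H (f ∘ h.symm)
    (hf.comp h.symm.continuous.continuousOn (by rintro _ ⟨v, hv, rfl⟩; simpa using hv))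
    (by rintro _ ⟨v, hv, rfl⟩; simpa using hfV hv)
  refine ⟨F ∘ h, hF.comp h.continuous.continuousOn (Set.mapsTo_image _ _),
    fun v hv => hFU (Set.mem_image_of_mem _ hv), fun v hv => ?_⟩
  simpa using hFf (Set.mem_image_of_mem _ hv)

/-- After a linear identification with Euclidean space, radial rescaling turns a convex body into
the ball. Prisms, cubes and balls of other norms thus become interchangeable. -/
theorem exists_homeomorph_closedBall {E : Type*} [NormedAddCommGroup E] [NormedSpace ℝ E]
    [FiniteDimensional ℝ E] {m : ℕ} (hm : Module.finrank ℝ E = m) {K : Set E} (hc : Convex ℝ K)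
    (hcl : IsClosed K) (hb : Bornology.IsBounded K) (hne : (interior K).Nonempty) :
    ∃ h : E ≃ₜ EuclideanSpace ℝ (Fin m),
      h '' K = Metric.closedBall 0 1 ∧ h '' frontier K = Metric.sphere 0 1 := by
  have L : E ≃L[ℝ] EuclideanSpace ℝ (Fin m) :=
    ContinuousLinearEquiv.ofFinrankEq (by rw [hm, finrank_euclideanSpace_fin])
  have hint : interior (L '' K) = L '' interior K := (L.toHomeomorph.image_interior K).symm
  have hfr : frontier (L '' K) = L '' frontier K := (L.toHomeomorph.image_frontier K).symm
  obtain ⟨h, -, h1, h2⟩ := exists_homeomorph_image_interior_closure_frontier_eq_unitBall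
    (s := L '' K) (hc.linear_image L.toLinearEquiv.toLinearMap) (by rw [hint]; exact hne.image _)
    (L.lipschitz.isBounded_image hb)
  have hcl' : IsClosed (L '' K) := L.toHomeomorph.isClosedMap _ hcl
  rw [hcl'.closure_eq] at h1
  rw [hfr] at h2
  exact ⟨L.toHomeomorph.trans h, by rw [← h1, ← Set.image_comp]; rfl,
    by rw [← h2, ← Set.image_comp]; rfl⟩

theorem SphereFills.fills_frontier {E : Type*} [NormedAddCommGroup E] [NormedSpace ℝ E]
    [FiniteDimensional ℝ E] {m : ℕ} (hm : Module.finrank ℝ E = m) {K : Set E} (hc : Convex ℝ K)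
    (hcl : IsClosed K) (hb : Bornology.IsBounded K) (hne : (interior K).Nonempty) {V U : Set X}
    (H : SphereFills m V U) : Fills K (frontier K) V U := by
  obtain ⟨h, h1, h2⟩ := exists_homeomorph_closedBall hm hc hcl hb hne
  exact Fills.of_image h (by rw [h1, h2]; exact H)

theorem SphereFills.of_fills_frontier {E : Type*} [NormedAddCommGroup E] [NormedSpace ℝ E]
    [FiniteDimensional ℝ E] {m : ℕ} (hm : Module.finrank ℝ E = m) {K : Set E} (hc : Convex ℝ K)
    (hcl : IsClosed K) (hb : Bornology.IsBounded K) (hne : (interior K).Nonempty) {V U : Set X}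
    (H : Fills K (frontier K) V U) : SphereFills m V U := by
  obtain ⟨h, h1, h2⟩ := exists_homeomorph_closedBall hm hc hcl hb hne
  refine Fills.of_image h.symm ?_
  rw [← h1, ← h2, ← Set.image_comp, ← Set.image_comp, h.symm_comp_self, Set.image_id, Set.image_id]
  exact H

/-- The sphere in dimension one is a pair of points and the ball is a segment between them. -/
theorem SphereFills.joinedIn {V U : Set X} (H : SphereFills 1 V U) {p q : X} (hp : p ∈ V)
    (hq : q ∈ V) : JoinedIn U p q := by
  classical
  let e : EuclideanSpace ℝ (Fin 1) := EuclideanSpace.single 0 1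
  have hnorm (v : EuclideanSpace ℝ (Fin 1)) : ‖v‖ = |v 0| := by
    rw [EuclideanSpace.norm_eq]; simp [Real.sqrt_sq_eq_abs]
  have hc : Continuous fun v : EuclideanSpace ℝ (Fin 1) => v 0 := by fun_prop
  have hclosed : IsClosed {v : EuclideanSpace ℝ (Fin 1) | 1 ≤ v 0} :=
    isClosed_le continuous_const hc
  have hclosed' : IsClosed {v : EuclideanSpace ℝ (Fin 1) | v 0 ≤ -1} :=
    isClosed_le hc continuous_const
  -- The jump at `0` is harmless, since the sphere lies in two disjoint closed half-lines.
  have hcont : ContinuousOn (fun v : EuclideanSpace ℝ (Fin 1) => if v 0 ≤ 0 then p else q)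
      (Metric.sphere 0 1) := by
    refine ContinuousOn.mono (s := {v | v 0 ≤ -1} ∪ {v | 1 ≤ v 0})
      (ContinuousOn.union_of_isClosed ?_ ?_ hclosed' hclosed) fun v hv => ?_
    · refine (continuousOn_const (c := p)).congr fun v hv => if_pos ?_
      have : v 0 ≤ -1 := hv
      linarith
    · refine (continuousOn_const (c := q)).congr fun v hv => if_neg ?_
      have : 1 ≤ v 0 := hv
      linarith
    · rw [mem_sphere_zero_iff_norm, hnorm] at hv
      rcases eq_or_eq_neg_of_abs_eq hv with h | h
      · exact Or.inr h.ge
      · exact Or.inl h.le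
  obtain ⟨F, hF, hFU, hFf⟩ := H _ hcont fun v _ => by
    split_ifs
    exacts [hp, hq]
  have hball : ∀ t ∈ Set.Icc (0 : ℝ) 1, (2 * t - 1) • e ∈ Metric.closedBall 0 1 := by
    intro t ht
    rw [mem_closedBall_zero_iff, norm_smul, PiLp.norm_single, norm_one, mul_one,
      Real.norm_eq_abs, abs_le]
    constructor <;> linarith [ht.1, ht.2]
  refine JoinedIn.ofLine (f := fun t => F ((2 * t - 1) • e)) (hF.comp ?_ hball) ?_ ?_ ?_
  · exact Continuous.continuousOn (by fun_prop)
  · have : (2 * (0 : ℝ) - 1) • e ∈ Metric.sphere 0 1 := by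
      rw [mem_sphere_zero_iff_norm, norm_smul, PiLp.norm_single]; norm_num
    rw [hFf this]
    exact if_pos (by simp [e])
  · have : (2 * (1 : ℝ) - 1) • e ∈ Metric.sphere 0 1 := by
      rw [mem_sphere_zero_iff_norm, norm_smul, PiLp.norm_single]; norm_num
    rw [hFf this]
    exact if_neg (by norm_num [e])
  · rintro _ ⟨t, ht, rfl⟩
    exact hFU (hball t ht)

end Filling

/-! ### The sphere as a disk with collapsed boundary -/

section CollapsedDisk

variable {E : Type*} [NormedAddCommGroup E] [NormedSpace ℝ E]

/-- The map of the unit disk onto the unit sphere of one dimension more that collapses the boundary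
of the disk, and all points outside, to the north pole. -/
noncomputable def diskToSphere (x : E) : WithLp 2 (E × ℝ) :=
  WithLp.toLp 2 ((2 * √(1 - ‖x‖ ^ 2)) • x, 2 * (min ‖x‖ 1) ^ 2 - 1)

theorem diskToSphere_fst (x : E) :
    (diskToSphere x).fst = (2 * √(1 - ‖x‖ ^ 2)) • x := rfl

theorem diskToSphere_snd (x : E) : (diskToSphere x).snd = 2 * (min ‖x‖ 1) ^ 2 - 1 := rfl

theorem continuous_diskToSphere : Continuous (diskToSphere : E → WithLp 2 (E × ℝ)) := by
  unfold diskToSphere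
  fun_prop

theorem diskToSphere_of_one_le {x : E} (hx : 1 ≤ ‖x‖) :
    diskToSphere x = WithLp.toLp 2 (0, 1) := by
  have : 1 - ‖x‖ ^ 2 ≤ 0 := by nlinarith
  rw [diskToSphere, Real.sqrt_eq_zero_of_nonpos this, min_eq_right hx]
  norm_num

theorem norm_diskToSphere (x : E) : ‖diskToSphere x‖ = 1 := by
  rw [← sq_eq_sq₀ (norm_nonneg _) zero_le_one, WithLp.prod_norm_sq_eq_of_L2]
  rcases le_total 1 ‖x‖ with h | h
  · rw [diskToSphere_of_one_le h]
    simp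
  · have h0 : 0 ≤ 1 - ‖x‖ ^ 2 := by nlinarith [norm_nonneg x]
    have hs := Real.sq_sqrt h0
    rw [diskToSphere_fst, diskToSphere_snd, norm_smul, min_eq_left h, mul_pow, Real.norm_eq_abs,
      Real.norm_eq_abs, sq_abs, sq_abs, mul_pow, hs]
    ring

theorem diskToSphere_injOn {x x' : E} (hx : ‖x‖ < 1) (hx' : ‖x'‖ ≤ 1)
    (h : diskToSphere x = diskToSphere x') : x = x' := by
  have h1 := congrArg WithLp.fst h
  have h2 := congrArg WithLp.snd h
  rw [diskToSphere_fst, diskToSphere_fst] at h1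
  rw [diskToSphere_snd, diskToSphere_snd, min_eq_left hx.le, min_eq_left hx'] at h2
  have hsq : ‖x‖ ^ 2 = ‖x'‖ ^ 2 := by linarith
  rw [← hsq] at h1
  have : 2 * √(1 - ‖x‖ ^ 2) ≠ 0 := by
    have : 0 < √(1 - ‖x‖ ^ 2) := Real.sqrt_pos.2 (by nlinarith [norm_nonneg x])
    positivity
  exact smul_right_injective E this h1

/-- The height `2‖x‖² - 1` determines `‖x‖`, and dividing by the radial factor `√(2 * (1 - v.snd))`
recovers `x`. At the north pole any unit vector serves, whence `Nontrivial E`. -/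
theorem exists_diskToSphere_eq [Nontrivial E] {v : WithLp 2 (E × ℝ)} (hv : ‖v‖ = 1) :
    ∃ x : E, ‖x‖ ≤ 1 ∧ diskToSphere x = v := by
  have hsq := WithLp.prod_norm_sq_eq_of_L2 v
  rw [hv, Real.norm_eq_abs, sq_abs] at hsq
  rcases lt_or_ge v.snd 1 with hlt | hge
  · have h0 : 0 < 2 * (1 - v.snd) := by linarith
    have hneg : -1 ≤ v.snd := by nlinarith [sq_nonneg ‖v.fst‖]
    have hpos : 0 < √(2 * (1 - v.snd)) := Real.sqrt_pos.2 h0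
    have hn : ‖(√(2 * (1 - v.snd)))⁻¹ • v.fst‖ ^ 2 = (1 + v.snd) / 2 := by
      rw [norm_smul, mul_pow, norm_inv, inv_pow, Real.norm_eq_abs, sq_abs, Real.sq_sqrt h0.le]
      field_simp
      linarith
    have hle : ‖(√(2 * (1 - v.snd)))⁻¹ • v.fst‖ ≤ 1 := by
      rw [← sq_le_one_iff₀ (norm_nonneg _), hn]
      linarith
    refine ⟨(√(2 * (1 - v.snd)))⁻¹ • v.fst, hle, ?_⟩
    have hroot : 2 * √(1 - (1 + v.snd) / 2) = √(2 * (1 - v.snd)) := by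
      rw [eq_comm, Real.sqrt_eq_iff_mul_self_eq h0.le (by positivity)]
      have := Real.mul_self_sqrt (show 0 ≤ 1 - (1 + v.snd) / 2 by linarith)
      linarith
    rw [diskToSphere, min_eq_left hle, hn, hroot, smul_smul, mul_inv_cancel₀ hpos.ne', one_smul]
    have : 2 * ((1 + v.snd) / 2) - 1 = v.snd := by ring
    rw [this]
    rfl
  · obtain ⟨x, hx⟩ := exists_norm_eq E zero_le_one
    refine ⟨x, hx.le, ?_⟩
    have h1 : v.snd = 1 := by nlinarith [sq_nonneg ‖v.fst‖]
    have h0 : v.fst = 0 := by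
      rw [h1] at hsq
      have : ‖v.fst‖ ^ 2 = 0 := by linarith
      simpa using this
    rw [diskToSphere_of_one_le hx.ge, ← h0, ← h1]
    rfl

theorem exists_smul_diskToSphere_eq [Nontrivial E] {v : WithLp 2 (E × ℝ)} (hv : ‖v‖ ≤ 1) :
    ∃ x : E, ‖x‖ ≤ 1 ∧ ‖v‖ • diskToSphere x = v := by
  rcases eq_or_ne v 0 with rfl | h0
  · exact ⟨0, by simp, by simp⟩
  · have hn : ‖v‖ ≠ 0 := norm_ne_zero_iff.2 h0
    obtain ⟨x, hx, hxv⟩ := exists_diskToSphere_eq (v := ‖v‖⁻¹ • v)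
      (by rw [norm_smul, norm_inv, norm_norm, inv_mul_cancel₀ hn])
    exact ⟨x, hx, by rw [hxv, smul_smul, mul_inv_cancel₀ hn, one_smul]⟩

/-- A map on the cylinder over the disk that is constant on the boundary of every level and on the
top descends to a map on the ball of one dimension more. -/
theorem exists_ball_map_of_cylinder [FiniteDimensional ℝ E] [Nontrivial E] {X : Type*}
    [TopologicalSpace X] (Φ : E × ℝ → X) (hΦ : Continuous Φ)
    (hside : ∀ x x', ∀ s ∈ Set.Icc (0 : ℝ) 1, ‖x‖ = 1 → ‖x'‖ = 1 → Φ (x, s) = Φ (x', s))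
    (htop : ∀ x x', Φ (x, 1) = Φ (x', 1)) :
    ∃ F : WithLp 2 (E × ℝ) → X, ContinuousOn F (Metric.closedBall 0 1) ∧
      ∀ x s, ‖x‖ ≤ 1 → s ∈ Set.Icc (0 : ℝ) 1 → F ((1 - s) • diskToSphere x) = Φ (x, s) := by
  classical
  have hnorm (x : E) {s : ℝ} (hs : s ∈ Set.Icc (0 : ℝ) 1) :
      ‖(1 - s) • diskToSphere x‖ = 1 - s := by
    rw [norm_smul, norm_diskToSphere, mul_one, Real.norm_of_nonneg (by linarith [hs.2])]
  have hPc : Continuous fun z : Metric.closedBall (0 : E) 1 × Set.Icc (0 : ℝ) 1 =>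
      (1 - (z.2 : ℝ)) • diskToSphere (z.1 : E) :=
    (continuous_const.sub (continuous_subtype_val.comp continuous_snd)).smul
      (continuous_diskToSphere.comp (continuous_subtype_val.comp continuous_fst))
  have hPmem (z : Metric.closedBall (0 : E) 1 × Set.Icc (0 : ℝ) 1) :
      (1 - (z.2 : ℝ)) • diskToSphere (z.1 : E) ∈ Metric.closedBall 0 1 := by
    rw [mem_closedBall_zero_iff, hnorm _ z.2.2]
    linarith [z.2.2.1]
  let P : C(Metric.closedBall (0 : E) 1 × Set.Icc (0 : ℝ) 1,
      Metric.closedBall (0 : WithLp 2 (E × ℝ)) 1) := ⟨fun z =>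
    ⟨_, hPmem z⟩, hPc.subtype_mk hPmem⟩
  have hPsurj : Function.Surjective P := by
    rintro ⟨v, hv⟩
    rw [mem_closedBall_zero_iff] at hv
    obtain ⟨x, hx, hxv⟩ := exists_smul_diskToSphere_eq hv
    refine ⟨⟨⟨x, mem_closedBall_zero_iff.2 hx⟩, ⟨1 - ‖v‖, by linarith, by linarith [norm_nonneg v]⟩⟩,
      Subtype.ext ?_⟩
    simp only [P, ContinuousMap.coe_mk, sub_sub_cancel, hxv]
  -- A continuous surjection from a compact space onto a Hausdorff space is a quotient map.
  have hquot : IsQuotientMap P := P.continuous.isClosedMap.isQuotientMap P.continuous hPsurj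
  let φ : C(Metric.closedBall (0 : E) 1 × Set.Icc (0 : ℝ) 1, X) :=
    ⟨fun z => Φ (z.1.1, z.2.1), hΦ.comp ((continuous_subtype_val.comp continuous_fst).prodMk
      (continuous_subtype_val.comp continuous_snd))⟩
  -- The norm `1 - s` determines the level. Only the top level (to the center) and the boundary of
  -- each level are collapsed.
  have hfib : Function.FactorsThrough φ P := by
    rintro ⟨⟨x, hx⟩, ⟨s, hs⟩⟩ ⟨⟨x', hx'⟩, ⟨s', hs'⟩⟩ h
    rw [mem_closedBall_zero_iff] at hx hx'
    have h : (1 - s) • diskToSphere x = (1 - s') • diskToSphere x' := congrArg Subtype.val h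
    have hss : s = s' := by
      have := congrArg norm h
      rw [hnorm x hs, hnorm x' hs'] at this
      linarith
    subst hss
    change Φ (x, s) = Φ (x', s)
    rcases eq_or_ne s 1 with rfl | hs1
    · exact htop x x'
    · have h := smul_right_injective _ (sub_ne_zero.2 hs1.symm) h
      rcases hx.lt_or_eq with hlt | heq
      · rw [diskToSphere_injOn hlt hx' h]
      · rcases hx'.lt_or_eq with hlt' | heq'
        · rw [diskToSphere_injOn hlt' hx h.symm]
        · exact hside x x' s hs heq heq'
  let ψ := hquot.lift φ hfib
  have hψ (z) : ψ (P z) = φ z := DFunLike.congr_fun (hquot.lift_comp φ hfib) z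
  refine ⟨fun v => if hv : v ∈ Metric.closedBall 0 1 then ψ ⟨v, hv⟩ else Φ 0, ?_, ?_⟩
  · rw [continuousOn_iff_continuous_domRestrict]
    convert! ψ.continuous using 1
    funext v
    exact dif_pos v.2
  · intro x s hx hs
    have hz := hψ ⟨⟨x, mem_closedBall_zero_iff.2 hx⟩, ⟨s, hs⟩⟩
    have hmem := (P ⟨⟨x, mem_closedBall_zero_iff.2 hx⟩, ⟨s, hs⟩⟩).2
    exact (dif_pos hmem).trans hz

end CollapsedDisk

/-! ### From null-homotopic loops to fillings of free spheres -/

section SemilocalFilling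

variable {X : Type*} [TopologicalSpace X] {n : ℕ}

theorem Cube.exists_disk_coordinates (n : ℕ) :
    ∃ (toDisk : (Fin n → unitInterval) → EuclideanSpace ℝ (Fin n))
      (ofDisk : EuclideanSpace ℝ (Fin n) → Fin n → unitInterval),
      Continuous toDisk ∧ Continuous ofDisk ∧ (∀ t, ‖toDisk t‖ ≤ 1) ∧
      (∀ t, ofDisk (toDisk t) = t) ∧ (∀ x, ‖x‖ ≤ 1 → toDisk (ofDisk x) = x) ∧
      (∀ t ∈ Cube.boundary (Fin n), ‖toDisk t‖ = 1) ∧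
      ∀ x, ‖x‖ = 1 → ofDisk x ∈ Cube.boundary (Fin n) := by
  obtain ⟨h, h1, h2⟩ := exists_homeomorph_closedBall (E := Fin n → ℝ) (m := n) (by simp)
    (convex_closedBall 0 1) Metric.isClosed_closedBall Metric.isBounded_closedBall
    ⟨0, Metric.ball_subset_interior_closedBall (Metric.mem_ball_self one_pos)⟩
  rw [frontier_closedBall _ one_ne_zero] at h2
  have hball {x : EuclideanSpace ℝ (Fin n)} (hx : ‖x‖ ≤ 1) : ‖h.symm x‖ ≤ 1 := by
    obtain ⟨v, hv, rfl⟩ := h1.superset (mem_closedBall_zero_iff.2 hx)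
    rwa [h.symm_apply_apply, ← mem_closedBall_zero_iff]
  refine ⟨fun t => h (Cube.toBall t), fun x => Cube.ofSpace (h.symm x),
    h.continuous.comp Cube.continuous_toBall, Cube.continuous_ofSpace.comp h.symm.continuous,
    fun t => ?_, fun t => ?_, fun x hx => ?_, fun t ht => ?_, fun x hx => ?_⟩
  · rw [← mem_closedBall_zero_iff, ← h1]
    exact Set.mem_image_of_mem _ (mem_closedBall_zero_iff.2 (Cube.norm_toBall_le t))
  · simp only [h.symm_apply_apply, Cube.ofSpace_toBall]
  · simp only [Cube.toBall_ofSpace (hball hx), h.apply_symm_apply]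
  · rw [← mem_sphere_zero_iff_norm, ← h2]
    exact Set.mem_image_of_mem _ (mem_sphere_zero_iff_norm.2 (Cube.norm_toBall_of_mem_boundary ht))
  · obtain ⟨v, hv, rfl⟩ := h2.superset (mem_sphere_zero_iff_norm.2 hx)
    refine Cube.ofSpace_mem_boundary ?_
    rw [h.symm_apply_apply, mem_sphere_zero_iff_norm.1 hv]

/-- A sphere in `V` becomes a loop at `y` once its pole is joined to `y` inside `U`. Shrinking the
connecting path and then applying the null-homotopy contracts the sphere freely, which is a filling
of the ball in polar coordinates. -/
theorem sphereFills_of_genLoop_null (hn : 1 ≤ n) {y : X} {U V : Set X}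
    (hV : V ⊆ U) (hVU : ∀ p ∈ V, JoinedIn U p y)
    (hU : ∀ α : GenLoop (Fin n) X y, (∀ t, α t ∈ U) → GenLoop.Homotopic α GenLoop.const) :
    SphereFills (n + 1) V Set.univ := by
  obtain ⟨toDisk, ofDisk, hto, hof, hnorm, hofto, htoof, hbto, hbof⟩ :=
    Cube.exists_disk_coordinates n
  have : Nonempty (Fin n) := ⟨⟨0, hn⟩⟩
  let E := EuclideanSpace ℝ (Fin n)
  have hrank : Module.finrank ℝ (WithLp 2 (E × ℝ)) = n + 1 := by
    rw [(WithLp.linearEquiv 2 ℝ (E × ℝ)).finrank_eq, Module.finrank_prod, finrank_euclideanSpace_fin,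
      Module.finrank_self]
  refine SphereFills.of_fills_frontier hrank (convex_closedBall (0 : WithLp 2 (E × ℝ)) 1)
    Metric.isClosed_closedBall Metric.isBounded_closedBall
    ⟨0, Metric.ball_subset_interior_closedBall (Metric.mem_ball_self one_pos)⟩ ?_
  rw [frontier_closedBall _ one_ne_zero]
  intro f hf hfV
  have hsph (x : E) : diskToSphere x ∈ Metric.sphere 0 1 :=
    mem_sphere_zero_iff_norm.2 (norm_diskToSphere x)
  have hfc : Continuous fun x : E => f (diskToSphere x) :=
    hf.comp_continuous continuous_diskToSphere hsph
  have hpole : (WithLp.toLp 2 (0, 1) : WithLp 2 (E × ℝ)) ∈ Metric.sphere 0 1 := by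
    obtain ⟨x, hx⟩ := exists_norm_eq E zero_le_one
    rw [← diskToSphere_of_one_le hx.ge]
    exact hsph x
  obtain ⟨p, hp⟩ := hVU _ (hfV hpole)
  let A : E → X := fun x => if ‖x‖ ≤ 1 then f (diskToSphere x) else p.extend (‖x‖ - 1)
  have hA : Continuous A := by
    refine Continuous.if_le hfc (p.continuous_extend.comp (continuous_norm.sub continuous_const))
      continuous_norm continuous_const fun x hx => ?_
    rw [hx, sub_self, Path.extend_zero, diskToSphere_of_one_le hx.ge]
  have hA1 {x : E} (hx : 1 ≤ ‖x‖) : A x = p.extend (‖x‖ - 1) := by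
    rcases hx.eq_or_lt with h | h
    · simp only [A, if_pos h.ge]
      rw [← h, sub_self, Path.extend_zero, diskToSphere_of_one_le hx]
    · exact if_neg (not_le.2 h)
  have hAU (x : E) : A x ∈ U := by
    simp only [A]
    split_ifs
    · exact hV (hfV (hsph x))
    · obtain ⟨t, ht⟩ : p.extend (‖x‖ - 1) ∈ Set.range p :=
        p.extend_range ▸ Set.mem_range_self (‖x‖ - 1)
      exact ht ▸ hp t
  have hsmul {r : ℝ} (hr : 0 ≤ r) {x : E} (hx : ‖x‖ = 1) : ‖r • x‖ = r := by
    rw [norm_smul, hx, mul_one, Real.norm_of_nonneg hr]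
  let α : GenLoop (Fin n) X y := ⟨⟨fun t => A ((2 : ℝ) • toDisk t),
    hA.comp (hto.const_smul (2 : ℝ))⟩, fun t ht => by
      change A ((2 : ℝ) • toDisk t) = y
      have h2 := hsmul zero_le_two (hbto t ht)
      rw [hA1 (by rw [h2]; norm_num), h2]
      norm_num⟩
  obtain ⟨G⟩ := hU α fun t => hAU _
  have hG (s) (t) (ht : t ∈ Cube.boundary (Fin n)) : G (s, t) = y :=
    (G.eq_fst s ht).trans (GenLoop.boundary α t ht)
  -- Up to level `1/2` the radius grows from `1` to `2`, from the given sphere to `α`; above it `G`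
  -- contracts `α`. Using `toDisk (ofDisk z.1)` instead of `z.1` makes the halves match outside the
  -- disk too.
  let Φ : E × ℝ → X := fun z => if z.2 ≤ 1 / 2 then A ((1 + 2 * z.2) • toDisk (ofDisk z.1))
    else G (Set.projIcc 0 1 zero_le_one (2 * z.2 - 1), ofDisk z.1)
  have hΦ : Continuous Φ := by
    refine Continuous.if_le (hA.comp ?_) (G.continuous.comp ?_) continuous_snd continuous_const
      fun z hz => ?_
    · exact (by fun_prop : Continuous fun z : E × ℝ => 1 + 2 * z.2).smul
        (hto.comp (hof.comp continuous_fst))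
    · exact (continuous_projIcc.comp (by fun_prop)).prodMk (hof.comp continuous_fst)
    · have h0 : Set.projIcc (0 : ℝ) 1 zero_le_one (2 * z.2 - 1) = 0 :=
        Set.projIcc_of_le_left _ (by linarith)
      rw [h0, G.apply_zero, hz]
      change _ = A ((2 : ℝ) • toDisk (ofDisk z.1))
      norm_num
  have hside (x x' : E) (s : ℝ) (hs : s ∈ Set.Icc (0 : ℝ) 1) (hx : ‖x‖ = 1) (hx' : ‖x'‖ = 1) :
      Φ (x, s) = Φ (x', s) := by
    have hr : 0 ≤ 1 + 2 * s := by linarith [hs.1]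
    have hlevel {x : E} (hx : ‖x‖ = 1) : A ((1 + 2 * s) • toDisk (ofDisk x)) = p.extend (2 * s) := by
      have h := hsmul hr hx
      rw [htoof x hx.le, hA1 (by rw [h]; linarith [hs.1]), h, add_sub_cancel_left]
    simp only [Φ, hlevel hx, hlevel hx', hG _ _ (hbof x hx), hG _ _ (hbof x' hx')]
  obtain ⟨F, hF, hFΦ⟩ := exists_ball_map_of_cylinder Φ hΦ hside fun x x' => by
    have h1 : Set.projIcc (0 : ℝ) 1 zero_le_one (2 * 1 - 1) = 1 :=
      Set.projIcc_of_right_le _ (by norm_num)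
    have h2 : ¬ (1 : ℝ) ≤ 1 / 2 := by norm_num
    simp only [Φ, if_neg h2, h1, G.apply_one]
    rfl
  refine ⟨F, hF, Set.mapsTo_univ _ _, fun v hv => ?_⟩
  obtain ⟨x, hx, rfl⟩ := exists_diskToSphere_eq (mem_sphere_zero_iff_norm.1 hv)
  have := hFΦ x 0 hx ⟨le_rfl, zero_le_one⟩
  rw [sub_zero, one_smul] at this
  rw [this]
  have h0 : (0 : ℝ) ≤ 1 / 2 := by norm_num
  simp only [Φ, if_pos h0, mul_zero, add_zero, one_smul, htoof x hx, A, if_pos hx]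

end SemilocalFilling

/-! ### Filling spheres of loops prism by prism -/

section LoopSpaceFilling

variable {Y : Type*} [TopologicalSpace Y] {m : ℕ}

/-- The form of `SphereFills` for a prism over the ball, given on the sides, bottom and top. -/
theorem SphereFills.prism {V U : Set Y} (H : SphereFills (m + 1) V U) {a b : ℝ} (hab : a < b)
    {g : EuclideanSpace ℝ (Fin m) × ℝ → Y} {σ₀ σ₁ : EuclideanSpace ℝ (Fin m) → Y}
    (hg : ContinuousOn g (Metric.sphere 0 1 ×ˢ Set.Icc a b))
    (hgV : Set.MapsTo g (Metric.sphere 0 1 ×ˢ Set.Icc a b) V)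
    (hσ₀ : ContinuousOn σ₀ (Metric.closedBall 0 1)) (hσ₀V : Set.MapsTo σ₀ (Metric.closedBall 0 1) V)
    (hσ₁ : ContinuousOn σ₁ (Metric.closedBall 0 1)) (hσ₁V : Set.MapsTo σ₁ (Metric.closedBall 0 1) V)
    (h₀ : ∀ d ∈ Metric.sphere 0 1, σ₀ d = g (d, a))
    (h₁ : ∀ d ∈ Metric.sphere 0 1, σ₁ d = g (d, b)) :
    ∃ F : EuclideanSpace ℝ (Fin m) × ℝ → Y,
      ContinuousOn F (Metric.closedBall 0 1 ×ˢ Set.Icc a b) ∧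
      Set.MapsTo F (Metric.closedBall 0 1 ×ˢ Set.Icc a b) U ∧
      (∀ d ∈ Metric.sphere 0 1, ∀ s ∈ Set.Icc a b, F (d, s) = g (d, s)) ∧
      (∀ d ∈ Metric.closedBall 0 1, F (d, a) = σ₀ d) ∧
      ∀ d ∈ Metric.closedBall 0 1, F (d, b) = σ₁ d := by
  have hfr : frontier (Metric.closedBall (0 : EuclideanSpace ℝ (Fin m)) 1 ×ˢ Set.Icc a b) =
      (Metric.closedBall 0 1 ×ˢ {a} ∪ Metric.closedBall 0 1 ×ˢ {b}) ∪
        Metric.sphere 0 1 ×ˢ Set.Icc a b := by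
    rw [frontier_prod_eq, Metric.isClosed_closedBall.closure_eq, isClosed_Icc.closure_eq,
      frontier_closedBall _ one_ne_zero, frontier_Icc hab.le, ← Set.prod_union]
    rfl
  have hfill := H.fills_frontier (E := EuclideanSpace ℝ (Fin m) × ℝ)
    (K := Metric.closedBall 0 1 ×ˢ Set.Icc a b) (by simp)
    ((convex_closedBall _ _).prod (convex_Icc a b)) (Metric.isClosed_closedBall.prod isClosed_Icc)
    (Metric.isBounded_closedBall.prod (Metric.isBounded_Icc a b)) (by
      rw [interior_prod_eq, interior_Icc]
      exact Set.Nonempty.prod ⟨0, Metric.ball_subset_interior_closedBall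
        (Metric.mem_ball_self one_pos)⟩ (Set.nonempty_Ioo.2 hab))
  rw [hfr] at hfill
  have hba : ¬ b ≤ a := not_le.2 hab
  -- On the rims the three pieces agree by `h₀` and `h₁`, so the order of the cases does not matter.
  let β : EuclideanSpace ℝ (Fin m) × ℝ → Y := fun z =>
    if z.2 ≤ a then σ₀ z.1 else if b ≤ z.2 then σ₁ z.1 else g z
  have hβa (d) : β (d, a) = σ₀ d := if_pos le_rfl
  have hβb (d) : β (d, b) = σ₁ d := by simp only [β, if_neg hba, if_pos le_rfl]
  have hβg : ∀ z ∈ Metric.sphere 0 1 ×ˢ Set.Icc a b, β z = g z := by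
    rintro ⟨d, s⟩ ⟨hd, hs⟩
    rcases hs.1.eq_or_lt with h | h
    · obtain rfl : a = s := h
      rw [hβa, h₀ d hd]
    · rcases hs.2.eq_or_lt with h' | h'
      · obtain rfl : s = b := h'
        rw [hβb, h₁ d hd]
      · have h : ¬ s ≤ a := not_le.2 h
        have h' : ¬ b ≤ s := not_le.2 h'
        simp only [β, if_neg h, if_neg h']
  obtain ⟨F, hF, hFU, hFβ⟩ := hfill β (by
    refine ((ContinuousOn.congr (f := fun z => σ₀ z.1) ?_ ?_).union_of_isClosed
      (ContinuousOn.congr (f := fun z => σ₁ z.1) ?_ ?_)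
        (Metric.isClosed_closedBall.prod isClosed_singleton)
        (Metric.isClosed_closedBall.prod isClosed_singleton)).union_of_isClosed (hg.congr hβg)
        ((Metric.isClosed_closedBall.prod isClosed_singleton).union
          (Metric.isClosed_closedBall.prod isClosed_singleton))
        (Metric.isClosed_sphere.prod isClosed_Icc)
    · exact hσ₀.comp continuousOn_fst fun z hz => hz.1
    · rintro ⟨d, s⟩ ⟨_, rfl⟩
      exact hβa d
    · exact hσ₁.comp continuousOn_fst fun z hz => hz.1
    · rintro ⟨d, s⟩ ⟨_, rfl⟩
      exact hβb d) (by
    rintro z ((⟨hd, hs⟩ | ⟨hd, hs⟩) | hz)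
    · obtain ⟨d, s⟩ := z
      obtain rfl : s = a := hs
      rw [hβa]
      exact hσ₀V hd
    · obtain ⟨d, s⟩ := z
      obtain rfl : s = b := hs
      rw [hβb]
      exact hσ₁V hd
    · rw [hβg z hz]
      exact hgV hz)
  refine ⟨F, hF, hFU, fun d hd s hs => ?_, fun d hd => ?_, fun d hd => ?_⟩
  · have hmem : (d, s) ∈ Metric.sphere (0 : EuclideanSpace ℝ (Fin m)) 1 ×ˢ Set.Icc a b :=
      Set.mk_mem_prod hd hs
    exact (hFβ (Set.mem_union_right _ hmem)).trans (hβg _ hmem)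
  · have hmem : (d, a) ∈ Metric.closedBall (0 : EuclideanSpace ℝ (Fin m)) 1 ×ˢ {a} :=
      Set.mk_mem_prod hd (Set.mem_singleton a)
    exact (hFβ (Set.mem_union_left _ (Set.mem_union_left _ hmem))).trans (hβa d)
  · have hmem : (d, b) ∈ Metric.closedBall (0 : EuclideanSpace ℝ (Fin m)) 1 ×ˢ {b} :=
      Set.mk_mem_prod hd (Set.mem_singleton b)
    exact (hFβ (Set.mem_union_left _ (Set.mem_union_right _ hmem))).trans (hβb d)

theorem Path.continuous_extend_uncurry {y z : Y} :
    Continuous fun q : Path y z × ℝ => q.1.extend q.2 :=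
  Continuous.pathExtend (γ := fun q : Path y z × ℝ => q.1)
    (Path.continuous_uncurry_iff.2 continuous_fst) continuous_snd

/-- Gluing of fillings of the prisms between consecutive slices. -/
theorem exists_glued_prisms {y₀ : Y} {K : ℕ} {a : ℕ → ℝ} (ha0 : a 0 = 0) (ha : StrictMono a)
    {V U : ℕ → Set Y} (hfill : ∀ i < K, SphereFills (m + 1) (V i) (U i))
    {g : EuclideanSpace ℝ (Fin m) × ℝ → Y}
    (hg : ContinuousOn g (Metric.sphere 0 1 ×ˢ Set.univ))
    (hgV : ∀ i < K, Set.MapsTo g (Metric.sphere 0 1 ×ˢ Set.Icc (a i) (a (i + 1))) (V i))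
    {σ : ℕ → EuclideanSpace ℝ (Fin m) → Y}
    (hσ : ∀ i ≤ K, ContinuousOn (σ i) (Metric.closedBall 0 1))
    (hσV : ∀ i < K, Set.MapsTo (σ i) (Metric.closedBall 0 1) (V i))
    (hσV' : ∀ i < K, Set.MapsTo (σ (i + 1)) (Metric.closedBall 0 1) (V i))
    (hσg : ∀ i ≤ K, ∀ d ∈ Metric.sphere 0 1, σ i d = g (d, a i))
    (hσ0 : ∀ d ∈ Metric.closedBall 0 1, σ 0 d = y₀) (k : ℕ) (hk : k ≤ K) :
    ∃ F : EuclideanSpace ℝ (Fin m) × ℝ → Y,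
      ContinuousOn F (Metric.closedBall 0 1 ×ˢ Set.Icc 0 (a k)) ∧
      (∀ d ∈ Metric.sphere 0 1, ∀ s ∈ Set.Icc 0 (a k), F (d, s) = g (d, s)) ∧
      (∀ d ∈ Metric.closedBall 0 1, F (d, 0) = y₀) ∧
      (∀ d ∈ Metric.closedBall 0 1, F (d, a k) = σ k d) ∧
      ∀ d ∈ Metric.closedBall 0 1, ∀ s ∈ Set.Ioc 0 (a k), ∃ i < K,
        s ∈ Set.Icc (a i) (a (i + 1)) ∧ F (d, s) ∈ U i := by
  induction k with
  | zero =>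
    refine ⟨fun z => σ 0 z.1, (hσ 0 hk).comp continuousOn_fst fun z hz => hz.1, fun d hd s hs => ?_,
      hσ0, fun d _ => rfl, fun d _ s hs => ?_⟩
    · rw [ha0] at hs
      obtain rfl : s = 0 := le_antisymm hs.2 hs.1
      exact (hσg 0 hk d hd).trans (by rw [ha0])
    -- The half-open interval in the last clause is empty here, so no prism is needed at the start.
    · rw [ha0] at hs
      exact absurd hs.1 (not_lt.2 hs.2)
  | succ k ih =>
    obtain ⟨F, hF, hFg, hF0, hFσ, hFU⟩ := ih (by omega)
    have hlt : a k < a (k + 1) := ha (Nat.lt_succ_self k)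
    have hk0 : 0 ≤ a k := ha0 ▸ ha.monotone (Nat.zero_le k)
    obtain ⟨G, hG, hGU, hGg, hGσ, hGσ'⟩ := (hfill k hk).prism hlt
      (hg.mono (Set.prod_mono_right (Set.subset_univ _))) (hgV k hk) (hσ k (by omega)) (hσV k hk)
      (hσ (k + 1) hk) (hσV' k hk) (hσg k (by omega)) (hσg (k + 1) hk)
    let H : EuclideanSpace ℝ (Fin m) × ℝ → Y := fun z => if z.2 ≤ a k then F z else G z
    have hHF {d s} (hs : s ≤ a k) : H (d, s) = F (d, s) := if_pos hs
    have hHG {d s} (hd : d ∈ Metric.closedBall 0 1) (hs : a k ≤ s) : H (d, s) = G (d, s) := by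
      rcases hs.eq_or_lt with rfl | h
      · rw [hHF le_rfl, hFσ d hd, hGσ d hd]
      · exact if_neg (not_le.2 h)
    refine ⟨H, ?_, fun d hd s hs => ?_, fun d hd => ?_, fun d hd => ?_, fun d hd s hs => ?_⟩
    · rw [← Set.Icc_union_Icc_eq_Icc hk0 hlt.le, Set.prod_union]
      exact (hF.congr fun z hz => hHF hz.2.2).union_of_isClosed
        (hG.congr fun z hz => hHG hz.1 hz.2.1) (Metric.isClosed_closedBall.prod isClosed_Icc)
        (Metric.isClosed_closedBall.prod isClosed_Icc)
    · rcases le_total s (a k) with h | h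
      · rw [hHF h, hFg d hd s ⟨hs.1, h⟩]
      · rw [hHG (Metric.sphere_subset_closedBall hd) h, hGg d hd s ⟨h, hs.2⟩]
    · rw [hHF hk0, hF0 d hd]
    · rw [hHG hd hlt.le, hGσ' d hd]
    · rcases le_total s (a k) with h | h
      · rw [hHF h]
        exact hFU d hd s ⟨hs.1, h⟩
      · rw [hHG hd h]
        exact ⟨k, hk, ⟨h, hs.2⟩, hGU ⟨hd, h, hs.2⟩⟩

/-- Every map of a sphere into `U` shrinks inside `U` on a smaller neighborhood. -/
def LocallyFills (m : ℕ) (Y : Type*) [TopologicalSpace Y] : Prop :=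
  ∀ y : Y, ∀ U ∈ 𝓝 y, ∃ V ∈ 𝓝 y, V ⊆ U ∧ SphereFills m V U

/-- Small spheres can be filled in the whole space. -/
def SemilocallyFills (m : ℕ) (Y : Type*) [TopologicalSpace Y] : Prop :=
  ∀ y : Y, ∃ V ∈ 𝓝 y, SphereFills m V (Set.univ : Set Y)

/-- Subdivide time so that `γ` maps each piece into one `V t`. For a sphere of loops near `γ`, first
fill its slices at the division times; sides and two slices then bound a prism, which `hfill` fills.
General `U` covers both the local and the semilocal case. -/
theorem LocallyFills.exists_nhds_loop (hY : LocallyFills m Y) {y₀ : Y} (γ : Path y₀ y₀)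
    {V U : unitInterval → Set Y} (hV : ∀ t, V t ∈ 𝓝 (γ t)) (hVU : ∀ t, V t ⊆ U t)
    (hfill : ∀ t, SphereFills (m + 1) (V t) (U t)) :
    ∃ W ∈ 𝓝 γ, ∀ f : EuclideanSpace ℝ (Fin m) → Path y₀ y₀, ContinuousOn f (Metric.sphere 0 1) →
      Set.MapsTo f (Metric.sphere 0 1) W → ∃ F : EuclideanSpace ℝ (Fin m) → Path y₀ y₀,
        ContinuousOn F (Metric.closedBall 0 1) ∧ Set.EqOn F f (Metric.sphere 0 1) ∧
        ∀ d ∈ Metric.closedBall 0 1, ∀ s, ∃ t, γ s ∈ V t ∧ F d s ∈ U t := by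
  classical
  obtain ⟨δ, hδ, hcover⟩ := lebesgue_number_lemma_of_metric (s := Set.Icc (0 : ℝ) 1)
    (c := fun t => γ.extend ⁻¹' interior (V t)) isCompact_Icc
    (fun t => isOpen_interior.preimage γ.continuous_extend) fun s hs => by
      refine Set.mem_iUnion.2 ⟨⟨s, hs⟩, ?_⟩
      rw [Set.mem_preimage, Path.extend_apply _ hs]
      exact mem_interior_iff_mem_nhds.2 (hV _)
  obtain ⟨K, hK⟩ := exists_nat_one_div_lt hδ
  have hK0 : (0 : ℝ) < K + 1 := by positivity
  let a : ℕ → ℝ := fun i => i / (K + 1)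
  have ha0 : a 0 = 0 := by simp [a]
  have haK : a (K + 1) = 1 := by simp only [a]; push_cast; exact div_self hK0.ne'
  have ha : StrictMono a := fun i j hij => div_lt_div_of_pos_right (by exact_mod_cast hij) hK0
  have hτ (i : ℕ) : ∃ t, i < K + 1 →
      ∀ s ∈ Set.Icc (a i) (a (i + 1)), γ.extend s ∈ interior (V t) := by
    by_cases hi : i < K + 1
    · obtain ⟨t, ht⟩ := hcover (a i) ⟨ha0 ▸ ha.monotone (Nat.zero_le i),
        haK ▸ ha.monotone hi.le⟩
      refine ⟨t, fun _ s hs => ht ?_⟩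
      have : a (i + 1) = a i + 1 / (K + 1) := by simp only [a]; push_cast; ring
      rw [Metric.mem_ball, Real.dist_eq, abs_of_nonneg (by linarith [hs.1])]
      linarith [hs.2]
    · exact ⟨0, fun h => absurd h hi⟩
  choose τ hτ using hτ
  -- A slice borders the prisms before and after it, so its filling has to lie in both sets `V`.
  let A : ℕ → Set Y := fun i => {z | ∀ j ∈ Finset.range (K + 1), j = i ∨ j + 1 = i → z ∈ V (τ j)}
  have hA : ∀ i, A i ∈ 𝓝 (γ.extend (a i)) := fun i => by
    refine (Filter.eventually_all_finset _).2 fun j hj => ?_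
    by_cases h : j = i ∨ j + 1 = i
    · have hmem : a i ∈ Set.Icc (a j) (a (j + 1)) := by
        rcases h with rfl | rfl
        · exact ⟨le_rfl, ha.monotone (Nat.le_succ _)⟩
        · exact ⟨ha.monotone (Nat.le_succ _), le_rfl⟩
      filter_upwards [mem_interior_iff_mem_nhds.1 (hτ j (Finset.mem_range.1 hj) _ hmem)]
        with z hz _ using hz
    · exact Filter.Eventually.of_forall fun z hz => absurd hz h
  choose W hW _ hWA using fun i => hY _ (A i) (hA i)
  refine ⟨{γ' | (∀ i ∈ Finset.range (K + 1), ∀ s ∈ Set.Icc (a i) (a (i + 1)),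
      γ'.extend s ∈ interior (V (τ i))) ∧ ∀ i ∈ Finset.range (K + 1), γ'.extend (a i) ∈ W i},
    Filter.Eventually.and ((Filter.eventually_all_finset _).2 fun i hi => ?_)
      ((Filter.eventually_all_finset _).2 fun i _ => ?_), fun f hf hfW => ?_⟩
  · exact isCompact_Icc.eventually_forall_of_forall_eventually fun s hs =>
      Path.continuous_extend_uncurry.continuousAt.eventually_mem
        (isOpen_interior.mem_nhds (hτ i (Finset.mem_range.1 hi) s hs))
  · exact (Path.continuous_extend_uncurry.comp (continuous_id.prodMk continuous_const)).continuousAt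
      |>.eventually_mem (hW i)
  · let g : EuclideanSpace ℝ (Fin m) × ℝ → Y := fun z => (f z.1).extend z.2
    have hg : ContinuousOn g (Metric.sphere 0 1 ×ˢ Set.univ) :=
      Path.continuous_extend_uncurry.comp_continuousOn
        ((hf.comp continuousOn_fst fun z hz => hz.1).prodMk continuousOn_snd)
    -- The end slices are filled by the constant `y₀`, so that the filling consists of loops.
    have hσ (i : ℕ) : ∃ σ : EuclideanSpace ℝ (Fin m) → Y, i ≤ K + 1 →
        ContinuousOn σ (Metric.closedBall 0 1) ∧ Set.MapsTo σ (Metric.closedBall 0 1) (A i) ∧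
        (∀ d ∈ Metric.sphere 0 1, σ d = g (d, a i)) ∧ (i = 0 ∨ i = K + 1 → ∀ d, σ d = y₀) := by
      by_cases hi : i = 0 ∨ i = K + 1
      · have hend (p : Path y₀ y₀) : p.extend (a i) = y₀ := by
          rcases hi with rfl | rfl
          · rw [ha0, Path.extend_zero]
          · rw [haK, Path.extend_one]
        exact ⟨fun _ => y₀, fun _ => ⟨continuousOn_const, fun d _ => hend γ ▸ mem_of_mem_nhds (hA i),
          fun d _ => (hend _).symm, fun _ _ => rfl⟩⟩
      · by_cases hiK : i ≤ K + 1
        · have hi' : i ∈ Finset.range (K + 1) := Finset.mem_range.2 (by omega)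
          obtain ⟨σ, h1, h2, h3⟩ := hWA i (fun d => g (d, a i))
            (hg.comp (by fun_prop) fun d hd => ⟨hd, trivial⟩) fun d hd => (hfW hd).2 i hi'
          exact ⟨σ, fun _ => ⟨h1, h2, h3, fun h => absurd h hi⟩⟩
        · exact ⟨fun _ => y₀, fun h => absurd h hiK⟩
    choose σ hσ using hσ
    obtain ⟨F, hF, hFg, hF0, hF1, hFU⟩ := exists_glued_prisms (y₀ := y₀) (K := K + 1) ha0 ha
      (V := fun i => V (τ i)) (U := fun i => U (τ i)) (fun i _ => hfill _) hg
      (fun i hi z hz => interior_subset ((hfW hz.1).1 i (Finset.mem_range.2 hi) _ hz.2))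
      (fun i hi => (hσ i hi).1)
      (fun i hi d hd => (hσ i hi.le).2.1 hd i (Finset.mem_range.2 hi) (Or.inl rfl))
      (fun i hi d hd => (hσ (i + 1) hi).2.1 hd i (Finset.mem_range.2 hi) (Or.inr rfl))
      (fun i hi => (hσ i hi).2.2.1) (fun d _ => (hσ 0 (Nat.zero_le _)).2.2.2 (Or.inl rfl) d)
      (K + 1) le_rfl
    rw [haK] at hF hFg hF1 hFU
    have hFcont {d} (hd : d ∈ Metric.closedBall 0 1) :
        Continuous fun t : unitInterval => F (d, t) :=
      hF.comp_continuous (by fun_prop) fun t => ⟨hd, t.2⟩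
    let P : EuclideanSpace ℝ (Fin m) → Path y₀ y₀ := fun d =>
      if hd : d ∈ Metric.closedBall 0 1 then
        { toFun := fun t => F (d, t)
          continuous_toFun := hFcont hd
          source' := hF0 d hd
          target' := (hF1 d hd).trans ((hσ (K + 1) le_rfl).2.2.2 (Or.inr rfl) d) }
      else Path.refl y₀
    have hP {d} (hd : d ∈ Metric.closedBall 0 1) (t : unitInterval) : P d t = F (d, t) := by
      simp only [P, dif_pos hd]
      rfl
    refine ⟨P, ?_, fun d hd => ?_, fun d hd s => ?_⟩
    · rw [continuousOn_iff_continuous_domRestrict, ← Path.continuous_uncurry_iff]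
      have hc : Continuous fun z : Metric.closedBall (0 : EuclideanSpace ℝ (Fin m)) 1 × unitInterval =>
          F (z.1, z.2) := hF.comp_continuous (by fun_prop) fun z => ⟨z.1.2, z.2.2⟩
      exact hc.congr fun z => (hP z.1.2 z.2).symm
    · ext t
      rw [hP (Metric.sphere_subset_closedBall hd), hFg d hd _ t.2]
      exact Path.extend_apply _ t.2
    · rw [hP hd]
      rcases s.2.1.eq_or_lt with h | h
      -- Time `0` is outside the half-open interval of `hFU`; there the value is `y₀ = γ 0`, which
      -- lies in `V 0 ⊆ U 0`.
      · have hs : s = 0 := Subtype.ext h.symm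
        rw [hs, Set.Icc.coe_zero, hF0 d hd, γ.source]
        have h0 : y₀ ∈ V 0 := by simpa using mem_of_mem_nhds (hV 0)
        exact ⟨0, h0, hVU 0 h0⟩
      · obtain ⟨i, hi, hs, hU⟩ := hFU d hd s ⟨h, s.2.2⟩
        refine ⟨τ i, ?_, hU⟩
        have := interior_subset (hτ i hi s hs)
        rwa [Path.extend_apply _ s.2] at this

end LoopSpaceFilling

/-! ### Iterated loop spaces and their path components -/

section IteratedLoopSpaces

open Filter

theorem SphereFills.of_homeomorph {Y Z : Type*} [TopologicalSpace Y] [TopologicalSpace Z]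
    (e : Y ≃ₜ Z) {m : ℕ} {V U : Set Y} (H : SphereFills m V U) :
    SphereFills m (e.symm ⁻¹' V) (e.symm ⁻¹' U) := by
  intro f hf hfV
  obtain ⟨F, hF, hFU, hFf⟩ := H (e.symm ∘ f) (e.symm.continuous.comp_continuousOn hf) hfV
  refine ⟨e ∘ F, e.continuous.comp_continuousOn hF, fun v hv => ?_, fun v hv => ?_⟩
  · simpa using hFU hv
  · simp [hFf hv]

theorem LocallyFills.of_homeomorph {Y Z : Type*} [TopologicalSpace Y] [TopologicalSpace Z]
    (e : Y ≃ₜ Z) {m : ℕ} (H : LocallyFills m Y) : LocallyFills m Z := by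
  intro z U hU
  obtain ⟨V, hV, hVU, hfill⟩ := H (e.symm z) (e ⁻¹' U)
    (e.continuous.continuousAt.preimage_mem_nhds (by simpa using hU))
  refine ⟨e.symm ⁻¹' V, e.symm.continuous.continuousAt.preimage_mem_nhds hV, fun v hv => ?_, ?_⟩
  · simpa using hVU hv
  · have := hfill.of_homeomorph e
    rwa [← Set.preimage_comp, e.self_comp_symm, Set.preimage_id] at this

theorem SemilocallyFills.of_homeomorph {Y Z : Type*} [TopologicalSpace Y] [TopologicalSpace Z]
    (e : Y ≃ₜ Z) {m : ℕ} (H : SemilocallyFills m Y) : SemilocallyFills m Z := by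
  intro z
  obtain ⟨V, hV, hfill⟩ := H (e.symm z)
  exact ⟨e.symm ⁻¹' V, e.symm.continuous.continuousAt.preimage_mem_nhds hV, hfill.of_homeomorph e⟩

theorem SemilocallyFills.loopSpace {Y : Type*} [TopologicalSpace Y] {m : ℕ}
    (hY : LocallyFills m Y) (hs : SemilocallyFills (m + 1) Y) (y : Y) :
    SemilocallyFills m (Path y y) := by
  intro γ
  choose V hV hfill using fun t => hs (γ t)
  obtain ⟨W, hW, h⟩ := hY.exists_nhds_loop γ hV (fun _ => Set.subset_univ _) hfill
  refine ⟨W, hW, fun f hf hfW => ?_⟩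
  obtain ⟨F, hF, hFf, -⟩ := h f hf hfW
  exact ⟨F, hF, Set.mapsTo_univ _ _, hFf⟩

theorem Path.exists_forall_dist_lt_subset {Y : Type*} [PseudoMetricSpace Y] {y z : Y}
    (γ : Path y z) {U : Set (Path y z)} (hU : U ∈ 𝓝 γ) :
    ∃ ε > 0, ∀ γ' : Path y z, (∀ s, dist (γ' s) (γ s) < ε) → γ' ∈ U := by
  rw [nhds_induced, mem_comap] at hU
  obtain ⟨T, hT, hTU⟩ := hU
  obtain ⟨ε, hε, hball⟩ := Metric.mem_nhds_iff.1 hT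
  exact ⟨ε, hε, fun γ' h => hTU (hball ((ContinuousMap.dist_lt_iff hε).2 h))⟩

theorem LocallyFills.loopSpace {Y : Type*} [PseudoMetricSpace Y] {m : ℕ}
    (hY : LocallyFills m Y) (hY' : LocallyFills (m + 1) Y) (y : Y) :
    LocallyFills m (Path y y) := by
  intro γ U hU
  obtain ⟨ε, hε, hεU⟩ := γ.exists_forall_dist_lt_subset hU
  -- With radius `ε / 2`, both `γ s` and `F d s` are close to the same `γ t`, so `F d` is uniformly
  -- `ε`-close to `γ`.
  choose V hV hVball hfill using fun t =>
    hY' (γ t) (Metric.ball (γ t) (ε / 2)) (Metric.ball_mem_nhds _ (half_pos hε))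
  obtain ⟨W, hW, h⟩ := hY.exists_nhds_loop γ hV hVball hfill
  refine ⟨W ∩ U, inter_mem hW hU, Set.inter_subset_right, fun f hf hfW => ?_⟩
  obtain ⟨F, hF, hFf, hclose⟩ := h f hf fun d hd => (hfW hd).1
  refine ⟨F, hF, fun d hd => hεU _ fun s => ?_, hFf⟩
  obtain ⟨t, h1, h2⟩ := hclose d hd s
  have h1 := Metric.mem_ball'.1 (hVball t h1)
  have h2 := Metric.mem_ball.1 h2
  linarith [dist_triangle (F d s) (γ t) (γ s)]

/-- Splitting off one coordinate exhibits the space as a loop space over `k - 1` coordinates. Each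
such step costs one dimension, so the induction hypothesis is applied with `r + 1`; `N` varies
because the remaining index type is a subtype. -/
theorem GenLoop.fills_of_fills {X : Type*} [MetricSpace X] (x : X) (k : ℕ) :
    ∀ r : ℕ, (∀ m, 1 ≤ m → m ≤ r + k → LocallyFills m X) → SemilocallyFills (r + k + 1) X →
      ∀ (N : Type) [Fintype N] [DecidableEq N], Fintype.card N = k →
        (∀ m, 1 ≤ m → m ≤ r → LocallyFills m (GenLoop N X x)) ∧
          SemilocallyFills (r + 1) (GenLoop N X x) := by
  induction k with
  | zero =>
    intro r hl hs N _ _ hN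
    have : IsEmpty N := Fintype.card_eq_zero_iff.1 hN
    let e := (genLoopHomeoOfIsEmpty (X := X) N x).symm
    exact ⟨fun m h1 hm => (hl m h1 hm).of_homeomorph e, hs.of_homeomorph e⟩
  | succ k ih =>
    intro r hl hs N _ _ hN
    have : Nonempty N := Fintype.card_pos_iff.1 (by omega)
    let i : N := Classical.arbitrary N
    have hcard : Fintype.card {j // j ≠ i} = k := by
      rw [Fintype.card_subtype_compl, Fintype.card_subtype_eq, hN, Nat.add_sub_cancel]
    obtain ⟨hl', hs'⟩ := ih (r + 1) (fun m h1 hm => hl m h1 (by omega))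
      (by rwa [show r + 1 + k + 1 = r + (k + 1) + 1 by omega]) {j // j ≠ i} hcard
    let e := (GenLoop.loopHomeo (X := X) (x := x) i).symm
    exact ⟨fun m h1 hm => ((hl' m h1 (by omega)).loopSpace (hl' (m + 1) (by omega) (by omega))
        _).of_homeomorph e,
      (SemilocallyFills.loopSpace (hl' (r + 1) (by omega) le_rfl) hs' _).of_homeomorph e⟩

theorem GenLoop.homotopic_of_joined {N X : Type*} [TopologicalSpace X] {x : X}
    {f g : GenLoop N X x} (h : Joined f g) : GenLoop.Homotopic f g := by
  obtain ⟨p⟩ := h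
  refine GenLoop.homotopic_of_continuous (fun q => p q.1 q.2) ?_ (fun t => ?_) (fun t => ?_)
    fun s t ht => GenLoop.boundary _ t ht
  · exact (p.continuous.comp continuous_fst).eval continuous_snd
  · simp only [p.source]
  · simp only [p.target]

/-- Every loop has a neighborhood whose points are all joined to it by paths, so each class has a
representative in a countable dense set. -/
theorem HomotopyGroup.countable_of_semilocallyFills {N X : Type*} [Countable N]
    [TopologicalSpace X] [SecondCountableTopology X] {x : X}
    (h : SemilocallyFills 1 (GenLoop N X x)) : Countable (HomotopyGroup N X x) := by
  obtain ⟨s, hs, hd⟩ := TopologicalSpace.exists_countable_dense (GenLoop N X x)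
  have : Countable s := hs.to_subtype
  have hsurj : Function.Surjective
      fun f : s => Quotient.mk (GenLoop.Homotopic.setoid N x) f.1 := by
    rintro ⟨f⟩
    obtain ⟨V, hV, hfill⟩ := h f
    obtain ⟨g, hgs, hgV⟩ := hd.inter_nhds_nonempty hV
    exact ⟨⟨g, hgs⟩, Quotient.sound (GenLoop.homotopic_of_joined
      (hfill.joinedIn hgV (mem_of_mem_nhds hV)).joined)⟩
  exact Function.Surjective.countable (β := HomotopyGroup N X x) hsurj

end IteratedLoopSpaces

/-! ### Conclusion for semilocally connected spaces -/

section Countability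

variable {X : Type*} {n : ℕ}

theorem IsLocallyNConnected.locallyFills [TopologicalSpace X] (h : IsLocallyNConnected (n - 1) X)
    {m : ℕ} (h1 : 1 ≤ m) (hm : m ≤ n) : LocallyFills m X := by
  intro y U hU
  obtain ⟨V, hV, hVU, hfill⟩ := h y U hU
  -- `SphereFills m` concerns spheres of dimension `m - 1`, so the range up to `n` matches local `(n
  -- - 1)`-connectedness.
  obtain ⟨k, rfl⟩ : ∃ k, m = k + 1 := ⟨m - 1, by omega⟩
  exact ⟨V, hV, hVU, fun f hf hfV => hfill k (by omega) f hf hfV⟩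

theorem IsSemilocallyNConnected.semilocallyFills [TopologicalSpace X] (hn : 1 ≤ n)
    (hloc : LocallyFills 1 X) (h : IsSemilocallyNConnected n X) : SemilocallyFills (n + 1) X := by
  intro y
  obtain ⟨U, hUo, hyU, hU⟩ := h y
  obtain ⟨V, hV, hVU, hfill⟩ := hloc y U (hUo.mem_nhds hyU)
  exact ⟨V, hV, sphereFills_of_genLoop_null hn hVU
    (fun p hp => hfill.joinedIn hp (mem_of_mem_nhds hV)) hU⟩

theorem IsSemilocallyNConnected.countable_homotopyGroup [MetricSpace X]
    [TopologicalSpace.SeparableSpace X] (hn : 1 ≤ n) (hloc : IsLocallyNConnected (n - 1) X)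
    (h : IsSemilocallyNConnected n X) (x : X) : Countable (HomotopyGroup.Pi n X x) := by
  have : SecondCountableTopology X := UniformSpace.secondCountable_of_separable X
  -- With `r = 0` all `n` dimensions are spent on the loop coordinates, and the filling of point
  -- pairs remains.
  refine HomotopyGroup.countable_of_semilocallyFills
    (GenLoop.fills_of_fills x n 0 (fun m h1 hm => hloc.locallyFills h1 (by omega)) ?_ (Fin n)
      (Fintype.card_fin n)).2
  rw [zero_add]
  exact h.semilocallyFills hn (hloc.locallyFills le_rfl hn)

theorem IsSemilocallyNConnected.isNHomotopicallyHausdorff [TopologicalSpace X]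
    (h : IsSemilocallyNConnected n X) : IsNHomotopicallyHausdorff n X := by
  intro y α hα
  obtain ⟨U, hUo, hyU, hU⟩ := h y
  exact ⟨U, hUo, hyU, fun β hβ hαβ => hα (hαβ.trans (hU β hβ))⟩

end Countability

theorem corollary3p7 {X : Type*} [MetricSpace X] [TopologicalSpace.SeparableSpace X]
    (n : ℕ) (hn : 1 ≤ n) (hconn : IsNConnected (n - 1) X)
    (hloc : IsLocallyNConnected (n - 1) X) (x : X) :
    IsSemilocallyNConnected n X ↔
      (IsNHomotopicallyHausdorff n X ∧ Countable (HomotopyGroup.Pi n X x)) := by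
  refine ⟨fun h => ⟨h.isNHomotopicallyHausdorff, h.countable_homotopyGroup hn hloc x⟩, ?_⟩
  rintro ⟨hH, hc⟩ y
  have := hconn.1
  exact isSemilocallyNConnectedAt_of_countable hn (hH y)
    (HomotopyGroup.countable_of_path (PathConnectedSpace.somePath y x) hc)
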